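/- Setting. Let $m\ge 1$ and $\mathcal X=\{x\in\mathbb R^d: Bx\le b,\ Cx\le c\}$ with $B\in\mathbb R^{d_1\times d}$, $b\in\mathbb R^{d_1}$, $C\in\mathbb R^{d_2\times d}$, $c\in\mathbb R^{d_2}$ (inequalities between vectors are componentwise). For $1\le j\le m$ let $\xi_j$ be a random element of a measurable space $\Xi_j$, $F_j:\mathcal X\times\Xi_j\to\mathbb R$ with $F_j(x;\xi_j)$ integrable for every $x\in\mathcal X$, $f_j(x)=\mathbb E[F_j(x;\xi_j)]$ and $f=\sum_{j=1}^m f_j$. Let $x^*$ be a minimizer of $f$ over $\mathcal X$ such that $Bx^*=b$ and $Cx^*<c$. Let $Q(z)=\arg\max_{x\in\mathcal X}\{\langle z,x\rangle-\tfrac12\|x\|^2\}$. Algorithm. Given (possibly random) $z_{j,0}\in\mathbb R^d$, random $m\times m$ weight matrices $A_k$, step sizes $\alpha_k$ and samples $\xi_{j,k}$, put for $k=1,2,\dots$ $$x_{j,k}=Q(z_{j,k-1}),\qquad z_{j,k}=\sum_{i:\,[A_k]_{ji}>0}[A_k]_{ji}\,z_{i,k-1}-\alpha_k\nabla F_j(x_{j,k};\xi_{j,k}),$$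 $\bar z_k=\frac1m\sum_{j=1}^m z_{j,k}$, $\bar x_{k+1}=Q(\bar z_k)$, and $\mathcal F_k=\sigma(z_{j,0},\xi_{j,t},A_t:\ 1\le j\le m,\ 1\le t\le k-1)$. Assumptions. 1. For every $j$ and every $s\in\Xi_j$, $F_j(\cdot;s)$ is convex and differentiable on $\mathcal X$, its gradient $\nabla F_j(x;s)$ is a measurable function of $(x,s)$, and $|F_j(x;s)-F_j(y;s)|\le L_{0,j}(s)\|x-y\|$ for $x,y\in\mathcal X$, where $L_{0,j}$ is measurable and $\mathbb E[|L_{0,j}(\xi_j)|^p]<\infty$ for some $p\ge2$. 2. Each $\nabla f_j$ is Lipschitz on $\mathcal X$, and there are $c_0,\epsilon>0$ with $\|\nabla f(x)-\nabla f(x^*)-\nabla^2f(x^*)(x-x^*)\|\le c_0\|x-x^*\|^2$ for all $x\in\mathcal X$ with $\|x-x^*\|\le\epsilon$. 3. (Restricted strong convexity) There is $\mu>0$ with $x^T\nabla^2f(x^*)x\ge\mu\|x\|^2$ for all $x$ with $Bx=0$. 4. (Nondegeneracy) $-\nabla f(x^*)\in\operatorname{ri}\mathcal N_{\mathcal X}(x^*)$,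 where $\mathcal N_{\mathcal X}(x^*)=\{v:\langle v,y-x^*\rangle\le0\ \forall y\in\mathcal X\}$ and $\operatorname{ri}$ is the relative interior. 5. For every $j$ the samples $\xi_{j,1},\xi_{j,2},\dots$ are i.i.d. copies of $\xi_j$, $\xi_{j,k}$ being drawn independently of $\mathcal F_k$; for $i\ne j$, $\xi_{i,k}$ and $\xi_{j,k}$ are conditionally independent given $\sigma(\mathcal F_k\cup\sigma(A_k))$; and $\xi_{j,k}$ is conditionally independent of $A_k$ given $\mathcal F_k$. 6. $A_1,A_2,\dots$ are i.i.d. and almost surely doubly stochastic (with nonnegative entries), the spectral norm of $\mathbb E[A_k^T(I_m-\frac1m\mathbf 1\mathbf 1^T)A_k]$ is less than $1$, and $A_k$ is independent of $\mathcal F_k$. 7. $\alpha_k=a/k^{\alpha}$ with $a>0$ and $\alpha\in(\frac23,1)$. Differentiability and gradients are understood relative to $\mathcal X$: $g$ is a gradient of $h$ at $x\in\mathcal X$ if $h(y)=h(x)+\langle g,y-x\rangle+o(\|y-x\|)$ as $y\to x$, $y\in\mathcal X$, and likewise $\nabla^2 f(x^*)$ is a derivative of $\nabla f$ at $x^*$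 relative to $\mathcal X$; if $\mathcal X$ has empty interior, $\nabla F_j$, $\nabla f_j$, $\nabla^2f(x^*)$ denote any fixed choice of such gradients and derivative, and $\nabla f=\sum_j\nabla f_j$. Conclusion. Almost surely there is a finite (random) $K$ such that for all $k\ge K$ $$B\bar x_k=b\quad\text{and}\quad C\bar x_k<c .$$ -/

import Mathlib

open MeasureTheory ProbabilityTheory
open scoped RealInnerProductSpace Matrix

namespace DDA

/-- `ℝ^d` with the Euclidean norm. -/
abbrev Vec (d : ℕ) : Type := EuclideanSpace ℝ (Fin d)

/-- Real matrices carry the product (entrywise) σ-algebra. -/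
instance instMeasurableSpaceMatrix (m n : ℕ) : MeasurableSpace (Matrix (Fin m) (Fin n) ℝ) :=
  inferInstanceAs (MeasurableSpace (Fin m → Fin n → ℝ))

/-! ### Constraint set, normal cone, regularizer and mirror map -/

/-- The polyhedron `{x : B x ≤ b, C x ≤ c}`; `≤` is componentwise. -/
def feasibleSet {d d₁ d₂ : ℕ} (B : Matrix (Fin d₁) (Fin d) ℝ) (b : Fin d₁ → ℝ)
    (C : Matrix (Fin d₂) (Fin d) ℝ) (c : Fin d₂ → ℝ) : Set (Vec d) :=
  {x | (∀ i, (B *ᵥ x.ofLp) i ≤ b i) ∧ ∀ i, (C *ᵥ x.ofLp) i ≤ c i}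

/-- The normal cone `{v : ⟨v, y - x⟩ ≤ 0 for all y ∈ X}`. -/
def normalCone {d : ℕ} (X : Set (Vec d)) (x : Vec d) : Set (Vec d) :=
  {v | ∀ y ∈ X, ⟪v, y - x⟫ ≤ 0}

/-- The Euclidean regularizer `ψ(x) = ‖x‖² / 2`. -/
noncomputable def euclideanReg {d : ℕ} (x : Vec d) : ℝ := ‖x‖ ^ 2 / 2

/-- The mirror map `Q(z) = argmax_{x ∈ X} (⟨z, x⟩ - ψ(x))`. The maximizer exists and is unique when
`X` is nonempty, closed and convex and `ψ` is the Euclidean regularizer. -/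
noncomputable def mirrorMap {d : ℕ} (ψ : Vec d → ℝ) (X : Set (Vec d)) (z : Vec d) : Vec d :=
  Classical.epsilon fun x => x ∈ X ∧ IsMaxOn (fun y => ⟪z, y⟫ - ψ y) X x

/-! ### Objective -/

/-- `f_j(x) = 𝔼[F_j(x; ξ_j)]`, where `ν j` is the law of `ξ_j`. -/
noncomputable def localObjective {m d : ℕ} {Ξ : Fin m → Type*} [∀ j, MeasurableSpace (Ξ j)]
    (F : (j : Fin m) → Vec d → Ξ j → ℝ) (ν : (j : Fin m) → Measure (Ξ j))
    (j : Fin m) (x : Vec d) : ℝ :=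
  ∫ s, F j x s ∂(ν j)

/-- `f = ∑_j f_j`. -/
noncomputable def objective {m d : ℕ} {Ξ : Fin m → Type*} [∀ j, MeasurableSpace (Ξ j)]
    (F : (j : Fin m) → Vec d → Ξ j → ℝ) (ν : (j : Fin m) → Measure (Ξ j)) (x : Vec d) : ℝ :=
  ∑ j, localObjective F ν j x

/-- The set of minimizers of `f` over `X`. -/
def optimalSet {d : ℕ} (f : Vec d → ℝ) (X : Set (Vec d)) : Set (Vec d) :=
  {x | x ∈ X ∧ IsMinOn f X x}

/-! ### The algorithm -/

/-- The in-neighbours `{i : [A]_{ji} > 0}` of agent `j`. -/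
noncomputable def neighbors {m : ℕ} (A : Matrix (Fin m) (Fin m) ℝ) (j : Fin m) : Finset (Fin m) :=
  open scoped Classical in Finset.univ.filter fun i => 0 < A j i

/-- The dual variables `z_{j,k}`, `k ≥ 0`, of distributed dual averaging:
`z_{j,k} = ∑_{i ∈ N_{j,k}} [A_k]_{ji} z_{i,k-1} - α_k ∇F_j(x_{j,k}; ξ_{j,k})` with
`x_{j,k} = Q(z_{j,k-1})`. Weights, step sizes and samples are used for times `k ≥ 1` only. -/
noncomputable def dual {m d : ℕ} {Ω : Type*} {Ξ : Fin m → Type*}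
    (X : Set (Vec d)) (ψ : Vec d → ℝ) (gradF : (j : Fin m) → Vec d → Ξ j → Vec d) (α : ℕ → ℝ)
    (z₀ : Fin m → Ω → Vec d) (ξ : (j : Fin m) → ℕ → Ω → Ξ j)
    (A : ℕ → Ω → Matrix (Fin m) (Fin m) ℝ) : ℕ → Fin m → Ω → Vec d
  | 0 => z₀
  | k + 1 => fun j ω =>
      ∑ i ∈ neighbors (A (k + 1) ω) j, A (k + 1) ω j i • dual X ψ gradF α z₀ ξ A k i ω
        - α (k + 1) • gradF j (mirrorMap ψ X (dual X ψ gradF α z₀ ξ A k j ω)) (ξ j (k + 1) ω)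

/-- `z̄_k = (1/m) ∑_j z_{j,k}`. -/
noncomputable def dualAvg {m d : ℕ} {Ω : Type*} {Ξ : Fin m → Type*}
    (X : Set (Vec d)) (ψ : Vec d → ℝ) (gradF : (j : Fin m) → Vec d → Ξ j → Vec d) (α : ℕ → ℝ)
    (z₀ : Fin m → Ω → Vec d) (ξ : (j : Fin m) → ℕ → Ω → Ξ j)
    (A : ℕ → Ω → Matrix (Fin m) (Fin m) ℝ) (k : ℕ) (ω : Ω) : Vec d :=
  (m : ℝ)⁻¹ • ∑ j, dual X ψ gradF α z₀ ξ A k j ω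

/-- `x̄_k = Q(z̄_{k-1})`, meaningful for `k ≥ 1`. -/
noncomputable def primalAvg {m d : ℕ} {Ω : Type*} {Ξ : Fin m → Type*}
    (X : Set (Vec d)) (ψ : Vec d → ℝ) (gradF : (j : Fin m) → Vec d → Ξ j → Vec d) (α : ℕ → ℝ)
    (z₀ : Fin m → Ω → Vec d) (ξ : (j : Fin m) → ℕ → Ω → Ξ j)
    (A : ℕ → Ω → Matrix (Fin m) (Fin m) ℝ) (k : ℕ) (ω : Ω) : Vec d :=
  mirrorMap ψ X (dualAvg X ψ gradF α z₀ ξ A (k - 1) ω)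

/-- The history `𝓕_k = σ(z_{j,0}, ξ_{j,t}, A_t : j ∈ V, 1 ≤ t ≤ k - 1)`. -/
abbrev history {m d : ℕ} {Ω : Type*} {Ξ : Fin m → Type*} [∀ j, MeasurableSpace (Ξ j)]
    (z₀ : Fin m → Ω → Vec d) (ξ : (j : Fin m) → ℕ → Ω → Ξ j)
    (A : ℕ → Ω → Matrix (Fin m) (Fin m) ℝ) (k : ℕ) : MeasurableSpace Ω :=
  (⨆ j, MeasurableSpace.comap (z₀ j) inferInstance) ⊔
    (⨆ j, ⨆ t ∈ Set.Ico 1 k, MeasurableSpace.comap (ξ j t) inferInstance) ⊔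
    (⨆ t ∈ Set.Ico 1 k, MeasurableSpace.comap (A t) inferInstance)

/-! ### Assumptions -/

/-- `X` and `Y` are conditionally independent given the σ-algebra `𝓖`:
`P(X ∈ s, Y ∈ t | 𝓖) = P(X ∈ s | 𝓖) P(Y ∈ t | 𝓖)` almost surely for all measurable `s`, `t`. -/
def CondIndepGiven {Ω β γ : Type*} [MeasurableSpace Ω] [MeasurableSpace β] [MeasurableSpace γ]
    (μ : Measure Ω) (𝓖 : MeasurableSpace Ω) (X : Ω → β) (Y : Ω → γ) : Prop :=
  ∀ s t, MeasurableSet s → MeasurableSet t →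
    (μ⟦X ⁻¹' s ∩ Y ⁻¹' t | 𝓖⟧) =ᵐ[μ] fun ω => (μ⟦X ⁻¹' s | 𝓖⟧) ω * (μ⟦Y ⁻¹' t | 𝓖⟧) ω

/-- The averaging matrix `𝟏𝟏ᵀ/m`. -/
noncomputable def averaging (m : ℕ) : Matrix (Fin m) (Fin m) ℝ := Matrix.of fun _ _ => (m : ℝ)⁻¹

/-- The disagreement matrix `Aᵀ (I - 𝟏𝟏ᵀ/m) A`. -/
noncomputable def disagreement {m : ℕ} (A : Matrix (Fin m) (Fin m) ℝ) :
    Matrix (Fin m) (Fin m) ℝ :=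
  Aᵀ * (1 - averaging m) * A

/-- The spectral norm of `𝔼[Aᵀ (I - 𝟏𝟏ᵀ/m) A]`, the expectation being taken entrywise. -/
noncomputable def mixingNorm {m : ℕ} {Ω : Type*} [MeasurableSpace Ω] (μ : Measure Ω)
    (A : Ω → Matrix (Fin m) (Fin m) ℝ) : ℝ :=
  ‖Matrix.toEuclideanCLM (𝕜 := ℝ) (n := Fin m)
    (Matrix.of fun i j => ∫ ω, disagreement (A ω) i j ∂μ)‖

/-- Standing conditions on the random objectives: `F_j(·; s)` is convex and differentiable on `X`
with gradient `gradF j · s` for every `s`, and Lipschitz on `X` with a measurable constant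
`L_{0,j}(s)` that has a finite `p`-th moment for some `p ≥ 2`. Differentiability and gradients are
relative to `X`, so that nothing is asked of `F_j` outside `X`; the gradient is the usual one
wherever `F_j(·; s)` is differentiable in the ambient space. -/
structure ObjectiveAssumption {m d : ℕ} {Ξ : Fin m → Type*} [∀ j, MeasurableSpace (Ξ j)]
    (X : Set (Vec d)) (F : (j : Fin m) → Vec d → Ξ j → ℝ)
    (gradF : (j : Fin m) → Vec d → Ξ j → Vec d) (ν : (j : Fin m) → Measure (Ξ j)) : Prop where
  integrable : ∀ j, ∀ x ∈ X, Integrable (F j x) (ν j)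
  measurable_grad : ∀ j, Measurable fun q : X × Ξ j => gradF j q.1 q.2
  convex : ∀ j s, ConvexOn ℝ X fun x => F j x s
  hasGradient : ∀ j s, ∀ x ∈ X, HasGradientWithinAt (fun y => F j y s) (gradF j x s) X x
  lipschitz : ∀ j, ∃ (p : ℝ) (L₀ : Ξ j → ℝ), 2 ≤ p ∧ Measurable L₀ ∧
    MemLp L₀ (ENNReal.ofReal p) (ν j) ∧
    ∀ s, ∀ x ∈ X, ∀ y ∈ X, |F j x s - F j y s| ≤ L₀ s * ‖x - y‖

/-- Conditions on the expected objectives: `gradf j` is the gradient of `f_j` on `X` and is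
Lipschitz there; `hess` is the Hessian of `f = ∑_j f_j` at `xstar`, the first-order expansion of
`∇f` at `xstar` has a locally quadratic remainder on `X`, and `hess` is positive definite on
`{x : B x = 0}`. -/
structure RegularityAssumption {m d d₁ : ℕ} {Ξ : Fin m → Type*} [∀ j, MeasurableSpace (Ξ j)]
    (X : Set (Vec d)) (B : Matrix (Fin d₁) (Fin d) ℝ)
    (F : (j : Fin m) → Vec d → Ξ j → ℝ) (ν : (j : Fin m) → Measure (Ξ j))
    (gradf : Fin m → Vec d → Vec d) (hess : Vec d →L[ℝ] Vec d) (xstar : Vec d) : Prop where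
  hasGradient : ∀ j, ∀ x ∈ X, HasGradientWithinAt (localObjective F ν j) (gradf j x) X x
  lipschitz : ∀ j, ∃ L > 0, ∀ x ∈ X, ∀ y ∈ X, ‖gradf j x - gradf j y‖ ≤ L * ‖x - y‖
  hasHessian : HasFDerivWithinAt (fun x => ∑ j, gradf j x) hess X xstar
  expansion : ∃ c₀ > 0, ∃ ε > 0, ∀ x ∈ X, ‖x - xstar‖ ≤ ε →
    ‖(∑ j, gradf j x) - (∑ j, gradf j xstar) - hess (x - xstar)‖ ≤ c₀ * ‖x - xstar‖ ^ 2
  restrictedStrongConvexity : ∃ κ > 0, ∀ x : Vec d, B *ᵥ x.ofLp = 0 → κ * ‖x‖ ^ 2 ≤ ⟪x, hess x⟫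

/-- Conditions on the samples: for each agent they are i.i.d. with law `ν j`, the sample of time `k`
being a fresh draw, independent of the history `𝓕_k`; distinct agents' samples of time `k` are
conditionally independent given `σ(𝓕_k, A_k)`; and each is conditionally independent of `A_k`
given `𝓕_k`. -/
structure SampleAssumption {m d : ℕ} {Ω : Type*} [MeasurableSpace Ω] {Ξ : Fin m → Type*}
    [∀ j, MeasurableSpace (Ξ j)] (μ : Measure Ω) (ν : (j : Fin m) → Measure (Ξ j))
    (z₀ : Fin m → Ω → Vec d) (ξ : (j : Fin m) → ℕ → Ω → Ξ j)
    (A : ℕ → Ω → Matrix (Fin m) (Fin m) ℝ) : Prop where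
  measurable_init : ∀ j, Measurable (z₀ j)
  measurable : ∀ j, ∀ k ≥ 1, Measurable (ξ j k)
  law : ∀ j, ∀ k ≥ 1, μ.map (ξ j k) = ν j
  indep : ∀ j, iIndepFun (fun k => ξ j (k + 1)) μ
  fresh : ∀ j, ∀ k ≥ 1, Indep (MeasurableSpace.comap (ξ j k) inferInstance) (history z₀ ξ A k) μ
  condIndep_agents : ∀ i j, i ≠ j → ∀ k ≥ 1,
    CondIndepGiven μ (history z₀ ξ A k ⊔ MeasurableSpace.comap (A k) inferInstance) (ξ i k) (ξ j k)
  condIndep_weights : ∀ j, ∀ k ≥ 1, CondIndepGiven μ (history z₀ ξ A k) (ξ j k) (A k)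

/-- Conditions on the weights: `A_1, A_2, …` are i.i.d. random doubly stochastic matrices, the
spectral norm of `𝔼[A_kᵀ (I - 𝟏𝟏ᵀ/m) A_k]` is less than `1`, and `A_k` is independent of `𝓕_k`. -/
structure WeightAssumption {m d : ℕ} {Ω : Type*} [MeasurableSpace Ω] {Ξ : Fin m → Type*}
    [∀ j, MeasurableSpace (Ξ j)] (μ : Measure Ω)
    (z₀ : Fin m → Ω → Vec d) (ξ : (j : Fin m) → ℕ → Ω → Ξ j)
    (A : ℕ → Ω → Matrix (Fin m) (Fin m) ℝ) : Prop where
  measurable : ∀ k ≥ 1, Measurable (A k)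
  stochastic : ∀ k ≥ 1, ∀ᵐ ω ∂μ, A k ω ∈ doublyStochastic ℝ (Fin m)
  indep : iIndepFun (fun k => A (k + 1)) μ
  identDistrib : ∀ k ≥ 1, IdentDistrib (A k) (A 1) μ μ
  mixing : ∀ k ≥ 1, mixingNorm μ (A k) < 1
  indep_history : ∀ k ≥ 1,
    Indep (MeasurableSpace.comap (A k) inferInstance) (history z₀ ξ A k) μ

end DDA

/-!
Let `P` be the orthogonal projection onto the direction of the affine span of `X`. A gradient
relative to `X` is determined only through its image under `P`, and `Q ∘ P = Q`, so all dual
variables and gradients may be projected by `P` without changing the primal iterates.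

Averaging the recursion over the agents turns it into dual averaging for `f` with step `α_k / m`, up
to gradient noise and the disagreement of the agents. With `p = x*` and `ψ = ‖·‖² / 2` on `X`, the
Fenchel coupling `ψ*(z) - ⟨z, p⟩ + ψ(p)`, which dominates `‖Q z - p‖² / 2`, is a Lyapunov function.
The mixing weights make the squared disagreement summable, the noise is a martingale difference
tested against a bounded vector, and so the coupling converges while `∑ α_k (f (x̄_k) - f (x*))` is
finite. As `x*` is the unique minimizer, `x̄_k → x*`.

Consequently `z̄_k`, normalized by the sum of the steps, converges to `-P ∇f(x*) / m`. By
nondegeneracy this limit pushes away from every feasible direction that leaves the active face with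
a rate proportional to the distance from the face. Were `Q (z̄_k)` off the face for some large `k`,
dropping its normal component would increase `⟨z̄_k, x⟩ - ‖x‖² / 2`. The constraints `C x < c` are
inherited from the limit.
-/

open Filter Topology

namespace DDA

/-! ### Projections onto convex sets and the Fenchel coupling -/

section ConvexProjection

variable {E : Type*} [NormedAddCommGroup E] [InnerProductSpace ℝ E]

/-- `Q` is the metric projection onto the convex set `X`, encoded by its variational inequality. It
is the mirror map of the Euclidean regularizer, see `isConvexProjection_mirrorMap`. -/
structure IsConvexProjection (X : Set E) (Q : E → E) : Prop where
  mem : ∀ z, Q z ∈ X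
  inner_le : ∀ z, ∀ y ∈ X, ⟪z - Q z, y - Q z⟫ ≤ 0

theorem isConvexProjection_mirrorMap {d : ℕ} {X : Set (Vec d)} (hne : X.Nonempty)
    (hcl : IsClosed X) (hX : Convex ℝ X) : IsConvexProjection X (mirrorMap euclideanReg X) := by
  have norm_sub_sq (z x : Vec d) : ‖z - x‖ ^ 2 = ‖z‖ ^ 2 - 2 * (⟪z, x⟫ - euclideanReg x) := by
    rw [norm_sub_sq_real, euclideanReg]; ring
  have isMaxOn_iff (z : Vec d) {x : Vec d} (hx : x ∈ X) :
      IsMaxOn (fun y => ⟪z, y⟫ - euclideanReg y) X x ↔ ∀ y ∈ X, ⟪z - x, y - x⟫ ≤ 0 := by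
    rw [← norm_eq_iInf_iff_real_inner_le_zero hX hx]
    have : Nonempty X := ⟨⟨x, hx⟩⟩
    have hbdd : BddBelow (Set.range fun y : X => ‖z - y‖) :=
      ⟨0, by rintro _ ⟨y, rfl⟩; exact norm_nonneg _⟩
    have hle (y : Vec d) : ⟪z, y⟫ - euclideanReg y ≤ ⟪z, x⟫ - euclideanReg x ↔
        ‖z - x‖ ≤ ‖z - y‖ := by
      rw [← sq_le_sq₀ (norm_nonneg _) (norm_nonneg _), norm_sub_sq, norm_sub_sq]
      constructor <;> intro h <;> linarith
    exact ⟨fun h => (le_ciInf fun y : X => (hle y).1 (h y.2)).antisymm (ciInf_le hbdd ⟨x, hx⟩),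
      fun h y hy => (hle y).2 (h ▸ ciInf_le hbdd ⟨y, hy⟩)⟩
  have spec (z : Vec d) : mirrorMap euclideanReg X z ∈ X ∧
      IsMaxOn (fun y => ⟪z, y⟫ - euclideanReg y) X (mirrorMap euclideanReg X z) := by
    obtain ⟨x, hx, hmin⟩ := exists_norm_eq_iInf_of_complete_convex hne hcl.isComplete hX z
    exact Classical.epsilon_spec (p := fun x => x ∈ X ∧ IsMaxOn _ X x)
      ⟨x, hx, (isMaxOn_iff z hx).2 ((norm_eq_iInf_iff_real_inner_le_zero hX hx).1 hmin)⟩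
  exact ⟨fun z => (spec z).1, fun z => (isMaxOn_iff z (spec z).1).1 (spec z).2⟩

theorem inner_starProjection_vectorSpan {X : Set E} [(vectorSpan ℝ X).HasOrthogonalProjection]
    {x y : E} (hx : x ∈ X) (hy : y ∈ X) (z : E) :
    ⟪(vectorSpan ℝ X).starProjection z, x - y⟫ = ⟪z, x - y⟫ := by
  rw [Submodule.inner_starProjection_left_eq_right,
    Submodule.starProjection_eq_self_iff.2]
  exact vsub_mem_vectorSpan ℝ hx hy

theorem starProjection_vectorSpan_eq {X : Set E} [(vectorSpan ℝ X).HasOrthogonalProjection]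
    {x u v : E} (hx : x ∈ X) (huv : ∀ y ∈ X, ⟪u, y - x⟫ = ⟪v, y - x⟫) :
    (vectorSpan ℝ X).starProjection u = (vectorSpan ℝ X).starProjection v := by
  rw [← sub_eq_zero, ← map_sub, Submodule.starProjection_apply_eq_zero_iff,
    ← Submodule.span_singleton_le_iff_mem, ← Submodule.isOrtho_iff_le,
    vectorSpan_eq_span_vsub_set_right ℝ hx, Submodule.isOrtho_span]
  rintro _ rfl _ ⟨y, hy, rfl⟩
  rw [inner_sub_left, sub_eq_zero]
  exact huv y hy

/-- The Fenchel coupling `ψ*(y) - ⟨y, p⟩ + ψ(p)` of a dual point `y` and a primal point `p`, for the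
Euclidean regularizer `ψ` of the set onto which `Q` projects. -/
noncomputable def coupling (Q : E → E) (p y : E) : ℝ :=
  ⟪y - Q y, Q y - p⟫ + ‖Q y - p‖ ^ 2 / 2

namespace IsConvexProjection

variable {X : Set E} {Q : E → E} (hQ : IsConvexProjection X Q)
include hQ

theorem inner_sub_nonneg {p : E} (hp : p ∈ X) (y : E) : 0 ≤ ⟪y - Q y, Q y - p⟫ := by
  have := hQ.inner_le y p hp
  rw [← neg_sub _ p, inner_neg_right] at this
  linarith

theorem norm_sub_sq_le_inner (z w : E) : ‖Q z - Q w‖ ^ 2 ≤ ⟪z - w, Q z - Q w⟫ := by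
  have hz := hQ.inner_sub_nonneg (hQ.mem w) z
  have hw := hQ.inner_le w _ (hQ.mem z)
  have hsum : ⟪z - Q z, Q z - Q w⟫ - ⟪w - Q w, Q z - Q w⟫ =
      ⟪z - w, Q z - Q w⟫ - ‖Q z - Q w‖ ^ 2 := by
    rw [← real_inner_self_eq_norm_sq, ← inner_sub_left, ← inner_sub_left]
    congr 1; abel
  linarith

theorem norm_sub_le (z w : E) : ‖Q z - Q w‖ ≤ ‖z - w‖ := by
  by_contra! h
  have := (hQ.norm_sub_sq_le_inner z w).trans (real_inner_le_norm _ _)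
  nlinarith [norm_nonneg (z - w)]

theorem continuous : Continuous Q :=
  (LipschitzWith.of_dist_le' (K := 1) fun z w => by
    simpa only [dist_eq_norm, one_mul] using hQ.norm_sub_le z w).continuous

theorem apply_starProjection_vectorSpan [(vectorSpan ℝ X).HasOrthogonalProjection] (z : E) :
    Q ((vectorSpan ℝ X).starProjection z) = Q z := by
  have := hQ.norm_sub_sq_le_inner ((vectorSpan ℝ X).starProjection z) z
  rw [inner_sub_left, inner_starProjection_vectorSpan (hQ.mem _) (hQ.mem _), sub_self] at this
  rwa [sq_nonpos_iff, norm_eq_zero, sub_eq_zero] at this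

theorem half_norm_sq_le_coupling {p : E} (hp : p ∈ X) (y : E) :
    ‖Q y - p‖ ^ 2 / 2 ≤ coupling Q p y :=
  le_add_of_nonneg_left (hQ.inner_sub_nonneg hp y)

theorem coupling_nonneg {p : E} (hp : p ∈ X) (y : E) : 0 ≤ coupling Q p y :=
  le_trans (by positivity) (hQ.half_norm_sq_le_coupling hp y)

theorem coupling_add_le (p y h : E) :
    coupling Q p (y + h) ≤ coupling Q p y + ⟪h, Q y - p⟫ + ‖h‖ ^ 2 / 2 := by
  have hvar : ⟪y - Q y, Q (y + h) - Q y⟫ ≤ 0 := hQ.inner_le y _ (hQ.mem _)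
  have hsq : 0 ≤ ‖h - (Q (y + h) - Q y)‖ ^ 2 := sq_nonneg _
  unfold coupling
  simp only [← real_inner_self_eq_norm_sq, inner_sub_left, inner_sub_right, inner_add_left]
    at hvar hsq ⊢
  rw [real_inner_comm (Q (y + h)) h, real_inner_comm (Q y) h,
    real_inner_comm (Q (y + h)) (Q y)] at *
  rw [real_inner_comm p (Q y), real_inner_comm p (Q (y + h))] at *
  linarith

theorem continuous_coupling (p : E) : Continuous (coupling Q p) := by
  have := hQ.continuous
  unfold coupling
  fun_prop

theorem norm_sub_le_one_add_coupling {p : E} (hp : p ∈ X) (y : E) :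
    ‖Q y - p‖ ≤ 1 + coupling Q p y := by
  nlinarith [hQ.half_norm_sq_le_coupling hp y, sq_nonneg (‖Q y - p‖ - 1)]

/-- Both directions of the segment from `p` to `Q y` are feasible at `Q y`, hence orthogonal to
`y - Q y`. -/
theorem coupling_eq_of_prolong {p y : E} (hp : p ∈ X)
    (hprolong : ∃ t > (0 : ℝ), Q y + t • (Q y - p) ∈ X) :
    coupling Q p y = ‖Q y - p‖ ^ 2 / 2 := by
  obtain ⟨t, ht, hmem⟩ := hprolong
  have hle := hQ.inner_le y _ hmem
  rw [add_sub_cancel_left, inner_smul_right] at hle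
  rw [coupling, le_antisymm (nonpos_of_mul_nonpos_right hle ht) (hQ.inner_sub_nonneg hp y),
    zero_add]

end IsConvexProjection

end ConvexProjection

/-! ### Polyhedra -/

section Span

variable {E : Type*} [NormedAddCommGroup E] [InnerProductSpace ℝ E]

theorem exists_abs_inner_le_of_mem_span {S : Set E} {v : E} (hv : v ∈ Submodule.span ℝ S) :
    ∃ K ≥ 0, ∀ (g : E) (L : ℝ), 0 ≤ L → (∀ w ∈ S, |⟪g, w⟫| ≤ L * ‖w‖) → |⟪g, v⟫| ≤ K * L := by
  induction hv using Submodule.span_induction with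
  | mem x hx =>
    exact ⟨‖x‖, norm_nonneg _, fun g L _ h => (h x hx).trans_eq (mul_comm _ _)⟩
  | zero => exact ⟨0, le_rfl, fun g L _ _ => by simp⟩
  | add x y _ _ hx hy =>
    obtain ⟨K₁, hK₁, hx⟩ := hx
    obtain ⟨K₂, hK₂, hy⟩ := hy
    refine ⟨K₁ + K₂, add_nonneg hK₁ hK₂, fun g L hL h => ?_⟩
    rw [inner_add_right, add_mul]
    exact (abs_add_le _ _).trans (add_le_add (hx g L hL h) (hy g L hL h))
  | smul a x _ hx =>
    obtain ⟨K, hK, hx⟩ := hx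
    refine ⟨|a| * K, by positivity, fun g L hL h => ?_⟩
    rw [inner_smul_right, abs_mul, mul_assoc]
    exact mul_le_mul_of_nonneg_left (hx g L hL h) (abs_nonneg _)

theorem exists_norm_starProjection_span_le [FiniteDimensional ℝ E] (S : Set E) :
    ∃ K ≥ 0, ∀ (g : E) (L : ℝ), 0 ≤ L → (∀ w ∈ S, |⟪g, w⟫| ≤ L * ‖w‖) →
      ‖(Submodule.span ℝ S).starProjection g‖ ≤ K * L := by
  set U := Submodule.span ℝ S
  let e := stdOrthonormalBasis ℝ E
  choose K hK0 hK using fun i =>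
    exists_abs_inner_le_of_mem_span (U.starProjection_apply_mem (e i))
  refine ⟨∑ i, K i, Finset.sum_nonneg fun i _ => hK0 i, fun g L hL h => ?_⟩
  calc ‖U.starProjection g‖ = ‖∑ i, ⟪e i, U.starProjection g⟫ • e i‖ := by rw [e.sum_repr']
    _ ≤ ∑ i, |⟪g, U.starProjection (e i)⟫| := by
      refine (norm_sum_le _ _).trans_eq (Finset.sum_congr rfl fun i _ => ?_)
      rw [norm_smul, e.norm_eq_one, mul_one, Real.norm_eq_abs, real_inner_comm,
        Submodule.inner_starProjection_left_eq_right]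
    _ ≤ (∑ i, K i) * L := by
      rw [Finset.sum_mul]
      exact Finset.sum_le_sum fun i _ => hK i g L hL h

end Span

section Polyhedron

variable {ι E : Type*} [NormedAddCommGroup E] [InnerProductSpace ℝ E]

/-- The polyhedron `{x : ⟨r i, x⟩ ≤ q i for all i}`, given by its constraint normals `r` and bounds
`q`. -/
def polyhedron (r : ι → E) (q : ι → ℝ) : Set E := {x | ∀ i, ⟪r i, x⟫ ≤ q i}

theorem polyhedron_eq_iInter (r : ι → E) (q : ι → ℝ) :
    polyhedron r q = ⋂ i, {x | ⟪r i, x⟫ ≤ q i} := by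
  ext x
  simp [polyhedron]

theorem convex_polyhedron (r : ι → E) (q : ι → ℝ) : Convex ℝ (polyhedron r q) := by
  rw [polyhedron_eq_iInter]
  exact convex_iInter fun i => convex_halfSpace_le (innerₗ E (r i)).isLinear (q i)

theorem isClosed_polyhedron (r : ι → E) (q : ι → ℝ) : IsClosed (polyhedron r q) := by
  rw [polyhedron_eq_iInter]
  exact isClosed_iInter fun i => isClosed_le (by fun_prop) continuous_const

theorem eventually_inner_lt [Finite ι] (r : ι → E) (q : ι → ℝ) (p : E) :
    ∀ᶠ x in 𝓝 p, ∀ i, ⟪r i, p⟫ < q i → ⟪r i, x⟫ < q i :=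
  eventually_all.2 fun i => eventually_imp_distrib_left.2 fun hi =>
    (Continuous.tendsto (by fun_prop) p : Tendsto (fun x => ⟪r i, x⟫) _ _).eventually_lt_const hi

theorem tendsto_add_smul_zero (x w : E) : Tendsto (fun t : ℝ => x + t • w) (𝓝[>] 0) (𝓝 x) := by
  have hcont : Continuous fun t : ℝ => x + t • w := by fun_prop
  simpa only [zero_smul, add_zero] using (hcont.tendsto 0).mono_left nhdsWithin_le_nhds

theorem eventually_add_smul_mem_polyhedron [Finite ι] {r : ι → E} {q : ι → ℝ} {x w : E}
    (hx : x ∈ polyhedron r q) (hw : ∀ i, ⟪r i, x⟫ = q i → ⟪r i, w⟫ ≤ 0) :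
    ∀ᶠ t : ℝ in 𝓝[>] 0, x + t • w ∈ polyhedron r q := by
  filter_upwards [(tendsto_add_smul_zero x w).eventually (eventually_inner_lt r q x),
    self_mem_nhdsWithin] with t hlt ht i
  rcases (hx i).lt_or_eq with hi | hi
  · exact (hlt i hi).le
  · rw [inner_add_right, inner_smul_right, hi]
    linarith [mul_nonpos_of_nonneg_of_nonpos (Set.mem_Ioi.1 ht).le (hw i hi)]

theorem eventually_prolong_mem_polyhedron [Finite ι] {r : ι → E} {q : ι → ℝ} {p : E}
    (hp : p ∈ polyhedron r q) :
    ∀ᶠ x in 𝓝[polyhedron r q] p, ∃ t > (0 : ℝ), x + t • (x - p) ∈ polyhedron r q := by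
  filter_upwards [self_mem_nhdsWithin, nhdsWithin_le_nhds (eventually_inner_lt r q p)]
    with x hx hlt
  refine ((eventually_add_smul_mem_polyhedron hx fun i hi => ?_).and
    self_mem_nhdsWithin).exists.imp fun t ht => ⟨ht.2, ht.1⟩
  rcases (hp i).lt_or_eq with h | h
  · exact absurd hi (hlt i h).ne
  · rw [inner_sub_right, hi, h, sub_self]

/-- The tangent cone at `x` depends only on the set of active constraints, so only finitely many
cones occur and the constant can be chosen independently of `x`. -/
theorem exists_norm_starProjection_vectorSpan_le [Finite ι] [FiniteDimensional ℝ E] (r : ι → E)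
    (q : ι → ℝ) :
    ∃ K ≥ 0, ∀ x ∈ polyhedron r q, ∀ (g : E) (L : ℝ), 0 ≤ L →
      (∀ w, (∀ᶠ t : ℝ in 𝓝[>] 0, x + t • w ∈ polyhedron r q) → |⟪g, w⟫| ≤ L * ‖w‖) →
      ‖(vectorSpan ℝ (polyhedron r q)).starProjection g‖ ≤ K * L := by
  set X := polyhedron r q
  have hactive (I : Set ι) : ∃ K ≥ 0, ∀ x ∈ X, {i | ⟪r i, x⟫ = q i} = I →
      ∀ (g : E) (L : ℝ), 0 ≤ L →
        (∀ w, (∀ᶠ t : ℝ in 𝓝[>] 0, x + t • w ∈ X) → |⟪g, w⟫| ≤ L * ‖w‖) →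
        ‖(vectorSpan ℝ X).starProjection g‖ ≤ K * L := by
    by_cases hI : ∃ x₀ ∈ X, {i | ⟪r i, x₀⟫ = q i} = I
    · obtain ⟨x₀, hx₀, hx₀I⟩ := hI
      obtain ⟨K, hK0, hK⟩ := exists_norm_starProjection_span_le ((· -ᵥ x₀) '' X)
      refine ⟨K, hK0, fun x hx hxI g L hL h => ?_⟩
      rw [vectorSpan_eq_span_vsub_set_right ℝ hx₀]
      refine hK g L hL ?_
      rintro _ ⟨y, hy, rfl⟩
      refine h _ (eventually_add_smul_mem_polyhedron hx fun i hi => ?_)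
      have hi₀ : ⟪r i, x₀⟫ = q i := (hx₀I.trans hxI.symm).ge hi
      simp only [vsub_eq_sub, inner_sub_right, hi₀]
      exact sub_nonpos.2 (hy i)
    · exact ⟨0, le_rfl, fun x hx hxI => absurd ⟨x, hx, hxI⟩ hI⟩
  choose K hK0 hK using hactive
  obtain ⟨M, hM⟩ := (Set.finite_range K).bddAbove
  refine ⟨M, (hK0 ∅).trans (hM ⟨∅, rfl⟩), fun x hx g L hL h => ?_⟩
  exact (hK _ x hx rfl g L hL h).trans (mul_le_mul_of_nonneg_right (hM ⟨_, rfl⟩) hL)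

end Polyhedron

section FeasibleSet

variable {d d₁ d₂ : ℕ} {B : Matrix (Fin d₁) (Fin d) ℝ} {b : Fin d₁ → ℝ}
  {C : Matrix (Fin d₂) (Fin d) ℝ} {c : Fin d₂ → ℝ}

/-- The `i`-th row of a matrix as a Euclidean vector. -/
noncomputable def rowVec {n : ℕ} (B : Matrix (Fin n) (Fin d) ℝ) (i : Fin n) : Vec d :=
  WithLp.toLp 2 (B i)

theorem inner_rowVec {n : ℕ} (B : Matrix (Fin n) (Fin d) ℝ) (i : Fin n) (x : Vec d) :
    ⟪rowVec B i, x⟫ = (B *ᵥ x.ofLp) i := by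
  simp [rowVec, PiLp.inner_apply, Matrix.mulVec, dotProduct, mul_comm]

theorem feasibleSet_eq_polyhedron :
    feasibleSet B b C c = polyhedron (Sum.elim (rowVec B) (rowVec C)) (Sum.elim b c) := by
  ext x
  simp [feasibleSet, polyhedron, inner_rowVec]

theorem convex_feasibleSet : Convex ℝ (feasibleSet B b C c) :=
  feasibleSet_eq_polyhedron ▸ convex_polyhedron _ _

theorem isClosed_feasibleSet : IsClosed (feasibleSet B b C c) :=
  feasibleSet_eq_polyhedron ▸ isClosed_polyhedron _ _

theorem isConvexProjection_mirrorMap_feasibleSet (hne : (feasibleSet B b C c).Nonempty) :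
    IsConvexProjection (feasibleSet B b C c) (mirrorMap euclideanReg (feasibleSet B b C c)) :=
  isConvexProjection_mirrorMap hne isClosed_feasibleSet convex_feasibleSet

theorem eventually_prolong_mem_feasibleSet {p : Vec d} (hp : p ∈ feasibleSet B b C c) :
    ∀ᶠ x in 𝓝[feasibleSet B b C c] p, ∃ t > (0 : ℝ), x + t • (x - p) ∈ feasibleSet B b C c := by
  rw [feasibleSet_eq_polyhedron] at hp ⊢
  exact eventually_prolong_mem_polyhedron hp

theorem eventually_mulVec_lt {p : Vec d} (hp : ∀ i, (C *ᵥ p.ofLp) i < c i) :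
    ∀ᶠ x : Vec d in 𝓝 p, ∀ i, (C *ᵥ x.ofLp) i < c i := by
  simp only [← inner_rowVec] at hp ⊢
  filter_upwards [eventually_inner_lt (rowVec C) c p] with x hx i using hx i (hp i)

theorem rowVec_mem_normalCone {p : Vec d} (hp : B *ᵥ p.ofLp = b) (l : Fin d₁) :
    rowVec B l ∈ normalCone (feasibleSet B b C c) p := by
  intro y hy
  rw [inner_sub_right, inner_rowVec, inner_rowVec, hp]
  exact sub_nonpos.2 (hy.1 l)

end FeasibleSet

/-! ### Gradients relative to a convex set -/

section Gradient

variable {E : Type*} [NormedAddCommGroup E] [InnerProductSpace ℝ E] {X : Set E}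

theorem tendsto_slope_of_hasFDerivWithinAt {G : Type*} [NormedAddCommGroup G] [NormedSpace ℝ G]
    {f : E → G} {f' : E →L[ℝ] G} {x w : E} (hf : HasFDerivWithinAt f f' X x)
    (hw : ∀ᶠ t : ℝ in 𝓝[>] 0, x + t • w ∈ X) :
    Tendsto (fun t : ℝ => t⁻¹ • (f (x + t • w) - f x)) (𝓝[>] 0) (𝓝 (f' w)) := by
  refine hf.lim (by simpa only [zero_add] using tendsto_add_smul_zero 0 w) hw
    (tendsto_const_nhds.congr' ?_)
  filter_upwards [self_mem_nhdsWithin] with t ht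
  rw [inv_smul_smul₀ (ne_of_gt ht)]

theorem eventually_add_smul_sub_mem (hX : Convex ℝ X) {x y : E} (hx : x ∈ X) (hy : y ∈ X) :
    ∀ᶠ t : ℝ in 𝓝[>] 0, x + t • (y - x) ∈ X := by
  filter_upwards [Ioc_mem_nhdsGT (zero_lt_one (α := ℝ))] with t ht
  exact hX.add_smul_sub_mem hx hy ⟨ht.1.le, ht.2⟩

variable [CompleteSpace E] {h : E → ℝ} {g x w : E}

theorem tendsto_slope_of_hasGradientWithinAt (hg : HasGradientWithinAt h g X x)
    (hw : ∀ᶠ t : ℝ in 𝓝[>] 0, x + t • w ∈ X) :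
    Tendsto (fun t : ℝ => t⁻¹ * (h (x + t • w) - h x)) (𝓝[>] 0) (𝓝 ⟪g, w⟫) := by
  simpa only [InnerProductSpace.toDual_apply_apply, smul_eq_mul] using
    tendsto_slope_of_hasFDerivWithinAt hg.hasFDerivWithinAt hw

theorem add_inner_le_of_convexOn (hh : ConvexOn ℝ X h) (hx : x ∈ X)
    (hg : HasGradientWithinAt h g X x) {y : E} (hy : y ∈ X) :
    h x + ⟪g, y - x⟫ ≤ h y := by
  suffices ⟪g, y - x⟫ ≤ h y - h x by linarith
  refine le_of_tendsto
    (tendsto_slope_of_hasGradientWithinAt hg (eventually_add_smul_sub_mem hh.1 hx hy)) ?_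
  filter_upwards [Ioc_mem_nhdsGT (zero_lt_one (α := ℝ))] with t ht
  have hconv := hh.2 hx hy (sub_nonneg.2 ht.2) ht.1.le (by ring)
  have hpoint : x + t • (y - x) = (1 - t) • x + t • y := by module
  rw [hpoint, inv_mul_le_iff₀ ht.1]
  simp only [smul_eq_mul] at hconv
  linarith

theorem abs_inner_le_of_lipschitz (hg : HasGradientWithinAt h g X x) {L : ℝ}
    (hL : ∀ y ∈ X, |h y - h x| ≤ L * ‖y - x‖) (hw : ∀ᶠ t : ℝ in 𝓝[>] 0, x + t • w ∈ X) :
    |⟪g, w⟫| ≤ L * ‖w‖ := by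
  refine le_of_tendsto (tendsto_slope_of_hasGradientWithinAt hg hw).abs ?_
  filter_upwards [hw, self_mem_nhdsWithin] with t ht (ht0 : 0 < t)
  have hlip := hL _ ht
  rw [add_sub_cancel_left, norm_smul, Real.norm_of_nonneg ht0.le] at hlip
  rw [abs_mul, abs_of_pos (inv_pos.2 ht0), inv_mul_le_iff₀ ht0]
  linarith

end Gradient

/-! ### Differentiation under the expectation -/

section Expectation

variable {E S : Type*} [NormedAddCommGroup E] [InnerProductSpace ℝ E] [CompleteSpace E]
  [MeasurableSpace S] {ν : Measure S} {X : Set E} {F : E → S → ℝ} {L₀ : S → ℝ} {g : E → S → E}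
  {G x : E}

theorem integral_inner_gradient (hint : ∀ x ∈ X, Integrable (F x) ν) (hL₀ : Integrable L₀ ν)
    (hlip : ∀ s, ∀ x ∈ X, ∀ y ∈ X, |F x s - F y s| ≤ L₀ s * ‖x - y‖) (hx : x ∈ X)
    (hF : ∀ s, HasGradientWithinAt (fun y => F y s) (g x s) X x)
    (hG : HasGradientWithinAt (fun y => ∫ s, F y s ∂ν) G X x) {w : E}
    (hw : ∀ᶠ t : ℝ in 𝓝[>] 0, x + t • w ∈ X) :
    ∫ s, ⟪g x s, w⟫ ∂ν = ⟪G, w⟫ := by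
  have hlim : Tendsto (fun t : ℝ => ∫ s, t⁻¹ * (F (x + t • w) s - F x s) ∂ν) (𝓝[>] 0)
      (𝓝 (∫ s, ⟪g x s, w⟫ ∂ν)) := by
    refine tendsto_integral_filter_of_dominated_convergence (fun s => L₀ s * ‖w‖) ?_ ?_
      (hL₀.mul_const _) (ae_of_all _ fun s => tendsto_slope_of_hasGradientWithinAt (hF s) hw)
    · filter_upwards [hw] with t ht
      exact (((hint _ ht).sub (hint x hx)).const_mul _).aestronglyMeasurable
    · filter_upwards [hw, self_mem_nhdsWithin] with t ht (ht0 : 0 < t)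
      refine ae_of_all _ fun s => ?_
      have hs := hlip s _ ht x hx
      rw [add_sub_cancel_left, norm_smul, Real.norm_of_nonneg ht0.le] at hs
      rw [norm_mul, Real.norm_of_nonneg (inv_pos.2 ht0).le, inv_mul_le_iff₀ ht0, Real.norm_eq_abs]
      linarith
  refine tendsto_nhds_unique hlim ((tendsto_slope_of_hasGradientWithinAt hG hw).congr' ?_)
  filter_upwards [hw] with t ht
  rw [integral_const_mul, integral_sub (hint _ ht) (hint x hx)]

theorem integral_starProjection_gradient [(vectorSpan ℝ X).HasOrthogonalProjection]
    (hX : Convex ℝ X) (hint : ∀ x ∈ X, Integrable (F x) ν) (hL₀ : Integrable L₀ ν)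
    (hlip : ∀ s, ∀ x ∈ X, ∀ y ∈ X, |F x s - F y s| ≤ L₀ s * ‖x - y‖) (hx : x ∈ X)
    (hF : ∀ s, HasGradientWithinAt (fun y => F y s) (g x s) X x)
    (hG : HasGradientWithinAt (fun y => ∫ s, F y s ∂ν) G X x)
    (hg : Integrable (fun s => (vectorSpan ℝ X).starProjection (g x s)) ν) :
    ∫ s, (vectorSpan ℝ X).starProjection (g x s) ∂ν = (vectorSpan ℝ X).starProjection G := by
  set P := (vectorSpan ℝ X).starProjection
  have hidem (v : E) : P (P v) = P v :=
    Submodule.starProjection_eq_self_iff.2 (Submodule.starProjection_apply_mem _ v)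
  calc ∫ s, P (g x s) ∂ν = P (∫ s, P (g x s) ∂ν) := by
        rw [← P.integral_comp_comm hg]
        simp only [hidem]
    _ = P G := starProjection_vectorSpan_eq hx fun y hy => by
      rw [real_inner_comm, ← integral_inner hg]
      simp only [real_inner_comm _ (y - x), P, inner_starProjection_vectorSpan hy hx]
      exact integral_inner_gradient hint hL₀ hlip hx hF hG (eventually_add_smul_sub_mem hX hx hy)

end Expectation

/-! ### Sharpness, identification of the active constraints and uniqueness of the minimizer -/

section Identification

variable {E : Type*} [NormedAddCommGroup E] [InnerProductSpace ℝ E]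

theorem exists_add_mem_of_mem_intrinsicInterior {N : Set E} {v : E} (h0 : 0 ∈ N)
    (hv : v ∈ intrinsicInterior ℝ N) :
    ∃ r > 0, ∀ w ∈ Submodule.span ℝ N, ‖w‖ ≤ r → v + w ∈ N := by
  obtain ⟨y, hy, rfl⟩ := mem_intrinsicInterior.1 hv
  obtain ⟨r, hr, hball⟩ := Metric.mem_nhds_iff.1 (mem_interior_iff_mem_nhds.1 hy)
  refine ⟨r / 2, half_pos hr, fun w hw hwr => ?_⟩
  have hmem : (y : E) + w ∈ affineSpan ℝ N := by
    have hdir : w ∈ (affineSpan ℝ N).direction := by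
      rwa [direction_affineSpan, vectorSpan_eq_span_vsub_set_right ℝ h0, show
        ((· -ᵥ (0 : E)) '' N) = N by simp]
    simpa only [vadd_eq_add, add_comm] using AffineSubspace.vadd_mem_of_mem_direction hdir y.2
  refine hball (a := ⟨y + w, hmem⟩) ?_
  rw [Metric.mem_ball, Subtype.dist_eq, dist_eq_norm, add_sub_cancel_left]
  linarith

theorem inner_starProjection_self (U : Submodule ℝ E) [U.HasOrthogonalProjection] (x : E) :
    ⟪U.starProjection x, x⟫ = ‖U.starProjection x‖ ^ 2 := by
  rw [← real_inner_self_eq_norm_sq, Submodule.inner_starProjection_left_eq_right,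
    Submodule.inner_starProjection_left_eq_right,
    Submodule.starProjection_eq_self_iff.2 (Submodule.starProjection_apply_mem _ _)]

/-- With `w` the projection of `x - p`, also `v + (r / ‖w‖) • w` is normal at `p`. -/
theorem exists_sharp_of_mem_intrinsicInterior {d : ℕ} {X : Set (Vec d)} {p v : Vec d}
    (hv : v ∈ intrinsicInterior ℝ (normalCone X p)) :
    ∃ r > 0, ∀ x ∈ X,
      r * ‖(Submodule.span ℝ (normalCone X p)).starProjection (x - p)‖ ≤ -⟪v, x - p⟫ := by
  obtain ⟨r, hr, hmem⟩ := exists_add_mem_of_mem_intrinsicInterior (fun y _ => by simp) hv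
  refine ⟨r, hr, fun x hx => ?_⟩
  set w := (Submodule.span ℝ (normalCone X p)).starProjection (x - p) with hw
  rcases eq_or_ne w 0 with h0 | h0
  · rw [h0, norm_zero, mul_zero]
    exact neg_nonneg.2 (intrinsicInterior_subset hv x hx)
  · have hcone := hmem ((r / ‖w‖) • w)
      (Submodule.smul_mem _ _ (Submodule.starProjection_apply_mem _ _))
      (by rw [norm_smul, norm_div, norm_norm, div_mul_cancel₀ _ (norm_ne_zero_iff.2 h0),
        Real.norm_of_nonneg hr.le]) x hx
    rw [inner_add_left, real_inner_smul_left, hw, inner_starProjection_self, ← hw, sq, ← mul_assoc,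
      div_mul_cancel₀ _ (norm_ne_zero_iff.2 h0)] at hcone
    linarith

/-- Optimality of `Q (z k)` compared with the feasible point obtained by removing its
`U`-component `w` gives `0 ≤ ⟨z k - Q (z k), w⟩`, while `z k - Q (z k)` is asymptotically a large
multiple of `v`, whose inner product with `w` is at most `-r ‖w‖`. -/
theorem IsConvexProjection.eventually_starProjection_eq_zero {X : Set E} {Q : E → E}
    (hQ : IsConvexProjection X Q) {U : Submodule ℝ E} [U.HasOrthogonalProjection] {p v : E} {r : ℝ}
    (hr : 0 < r) (hv : v ∈ U) (hsharp : ∀ x ∈ X, r * ‖U.starProjection (x - p)‖ ≤ -⟪v, x - p⟫)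
    (hlocal : ∀ᶠ x in 𝓝[X] p, x - U.starProjection (x - p) ∈ X) {z : ℕ → E} {s : ℕ → ℝ}
    (hs : Tendsto s atTop atTop) (hz : Tendsto (fun k => (s k)⁻¹ • z k) atTop (𝓝 v))
    (hx : Tendsto (fun k => Q (z k)) atTop (𝓝 p)) :
    ∀ᶠ k in atTop, U.starProjection (Q (z k) - p) = 0 := by
  have hdir : Tendsto (fun k => (s k)⁻¹ • (z k - Q (z k))) atTop (𝓝 v) := by
    simpa only [smul_sub, zero_smul, sub_zero, Pi.inv_apply] using
      hz.sub (hs.inv_tendsto_atTop.smul hx)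
  have hfeas := (tendsto_nhdsWithin_iff.2 ⟨hx, Eventually.of_forall fun k => hQ.mem _⟩).eventually
    hlocal
  filter_upwards [hfeas, hs.eventually_gt_atTop 0,
    (tendsto_iff_norm_sub_tendsto_zero.1 hdir).eventually_lt_const hr] with k hk hsk hnear
  set w := U.starProjection (Q (z k) - p) with hw
  set y := (s k)⁻¹ • (z k - Q (z k)) with hy
  have hopt : 0 ≤ ⟪y, w⟫ := by
    have := hQ.inner_le (z k) _ hk
    rw [sub_sub_cancel_left, inner_neg_right, neg_nonpos] at this
    rw [hy, real_inner_smul_left]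
    exact mul_nonneg (inv_pos.2 hsk).le this
  have hvw : ⟪v, w⟫ = ⟪v, Q (z k) - p⟫ := by
    rw [hw, ← Submodule.inner_starProjection_left_eq_right,
      Submodule.starProjection_eq_self_iff.2 hv]
  have hsplit : ⟪y, w⟫ = ⟪v, w⟫ + ⟪y - v, w⟫ := by rw [inner_sub_left]; ring
  have hcs := real_inner_le_norm (y - v) w
  have := hsharp _ (hQ.mem (z k))
  by_contra h
  nlinarith [norm_pos_iff.2 h]

end Identification

theorem eq_of_isMinOn_of_hessian_pos {E : Type*} [NormedAddCommGroup E] [InnerProductSpace ℝ E]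
    [CompleteSpace E] {X : Set E} {f : E → ℝ} {g : E → E} {H : E →L[ℝ] E} {p x : E}
    (hf : ConvexOn ℝ X f) (hg : ∀ y ∈ X, HasGradientWithinAt f (g y) X y)
    (hH : HasFDerivWithinAt g H X p) (hp : p ∈ X) (hx : x ∈ X) (hmin : IsMinOn f X p)
    (hfx : f x ≤ f p) (hpos : ⟪g p, x - p⟫ = 0 → x ≠ p → 0 < ⟪x - p, H (x - p)⟫) : x = p := by
  set u := x - p with hu
  have hseg := eventually_add_smul_sub_mem hf.1 hp hx
  have hle (t : ℝ) (ht : 0 ≤ t) (ht1 : t < 1) : ⟪g (p + t • u), u⟫ ≤ 0 := by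
    have hmem := hf.1.add_smul_sub_mem hp hx ⟨ht, ht1.le⟩
    have hsub := add_inner_le_of_convexOn hf hmem (hg _ hmem) hx
    rw [show x - (p + t • (x - p)) = (1 - t) • u by rw [hu]; module, inner_smul_right] at hsub
    have := hmin hmem
    simp only [Set.mem_ofPred_eq] at this
    exact nonpos_of_mul_nonpos_right (by linarith) (sub_pos.2 ht1)
  have hfirst : ⟪g p, u⟫ = 0 := by
    refine le_antisymm (by simpa using hle 0 le_rfl one_pos)
      (ge_of_tendsto (tendsto_slope_of_hasGradientWithinAt (hg p hp) hseg) ?_)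
    filter_upwards [hseg, self_mem_nhdsWithin] with t hmem (ht : 0 < t)
    exact mul_nonneg (inv_pos.2 ht).le (sub_nonneg.2 (hmin hmem))
  have hsecond : ⟪u, H u⟫ ≤ 0 := by
    refine le_of_tendsto (tendsto_const_nhds.inner (tendsto_slope_of_hasFDerivWithinAt hH hseg)) ?_
    filter_upwards [Ioo_mem_nhdsGT (zero_lt_one (α := ℝ))] with t ht
    rw [inner_smul_right, inner_sub_right, real_inner_comm, real_inner_comm _ u, hfirst, sub_zero]
    exact mul_nonpos_of_nonneg_of_nonpos (inv_pos.2 ht.1).le (hle t ht.1.le ht.2)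
  by_contra h
  exact (hpos hfirst h).not_ge hsecond

section ActiveConstraints

variable {d d₁ d₂ : ℕ} {B : Matrix (Fin d₁) (Fin d) ℝ} {b : Fin d₁ → ℝ}
  {C : Matrix (Fin d₂) (Fin d) ℝ} {c : Fin d₂ → ℝ} {p v : Vec d}

theorem mulVec_eq_of_starProjection_eq_zero (hp : B *ᵥ p.ofLp = b) {x : Vec d}
    (hx : (Submodule.span ℝ (normalCone (feasibleSet B b C c) p)).starProjection (x - p) = 0) :
    B *ᵥ x.ofLp = b := by
  ext l
  have horth := (Submodule.starProjection_apply_eq_zero_iff _).1 hx _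
    (Submodule.subset_span (rowVec_mem_normalCone hp l))
  rwa [inner_sub_right, inner_rowVec, inner_rowVec, hp, sub_eq_zero] at horth

theorem eventually_sub_starProjection_mem_feasibleSet (hp : B *ᵥ p.ofLp = b)
    (hc : ∀ i, (C *ᵥ p.ofLp) i < c i) :
    ∀ᶠ x in 𝓝 p, x - (Submodule.span ℝ (normalCone (feasibleSet B b C c) p)).starProjection
      (x - p) ∈ feasibleSet B b C c := by
  set P := (Submodule.span ℝ (normalCone (feasibleSet B b C c) p)).starProjection
  have hlim : Tendsto (fun x => x - P (x - p)) (𝓝 p) (𝓝 p) := by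
    have hcont : Continuous fun x => x - P (x - p) := by fun_prop
    simpa only [sub_self, map_zero, sub_zero] using hcont.tendsto p
  filter_upwards [hlim.eventually (eventually_mulVec_lt hc)] with x hx
  refine ⟨fun l => (congrFun (mulVec_eq_of_starProjection_eq_zero (c := c) (C := C) hp ?_) l).le,
    fun i => (hx i).le⟩
  rw [sub_right_comm, map_sub, sub_eq_zero, eq_comm]
  exact Submodule.starProjection_eq_self_iff.2 (Submodule.starProjection_apply_mem _ _)

theorem eventually_active_of_tendsto (hactive : B *ᵥ p.ofLp = b)
    (hinactive : ∀ i, (C *ᵥ p.ofLp) i < c i)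
    (hv : v ∈ intrinsicInterior ℝ (normalCone (feasibleSet B b C c) p)) {κ : ℝ} (hκ : 0 < κ)
    {z : ℕ → Vec d} {s : ℕ → ℝ} (hs : Tendsto s atTop atTop)
    (hz : Tendsto (fun k => (s k)⁻¹ • z k) atTop
      (𝓝 (κ • (vectorSpan ℝ (feasibleSet B b C c)).starProjection v)))
    (hx : Tendsto (fun k => mirrorMap euclideanReg (feasibleSet B b C c) (z k)) atTop (𝓝 p)) :
    ∀ᶠ k in atTop, B *ᵥ (mirrorMap euclideanReg (feasibleSet B b C c) (z k)).ofLp = b ∧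
      ∀ i, (C *ᵥ (mirrorMap euclideanReg (feasibleSet B b C c) (z k)).ofLp) i < c i := by
  have hp : p ∈ feasibleSet B b C c := ⟨fun i => (congrFun hactive i).le, fun i => (hinactive i).le⟩
  have hinner {x : Vec d} (hx : x ∈ feasibleSet B b C c) :
      ⟪(vectorSpan ℝ (feasibleSet B b C c)).starProjection v, x - p⟫ = ⟪v, x - p⟫ :=
    inner_starProjection_vectorSpan hx hp v
  have hcone : (vectorSpan ℝ (feasibleSet B b C c)).starProjection v ∈
      normalCone (feasibleSet B b C c) p :=
    fun x hx => (hinner hx).trans_le (intrinsicInterior_subset hv x hx)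
  obtain ⟨r, hr, hsharp⟩ := exists_sharp_of_mem_intrinsicInterior hv
  have hnormal := (isConvexProjection_mirrorMap_feasibleSet
    ⟨p, hp⟩).eventually_starProjection_eq_zero (mul_pos hκ hr)
    (Submodule.smul_mem _ κ (Submodule.subset_span hcone))
    (fun x hx => by
      rw [real_inner_smul_left, hinner hx, mul_assoc, ← mul_neg]
      exact mul_le_mul_of_nonneg_left (hsharp x hx) hκ.le)
    ((eventually_sub_starProjection_mem_feasibleSet hactive hinactive).filter_mono
      nhdsWithin_le_nhds) hs hz hx
  filter_upwards [hnormal, hx.eventually (eventually_mulVec_lt hinactive)] with k hk hlt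
  exact ⟨mulVec_eq_of_starProjection_eq_zero hactive hk, hlt⟩

end ActiveConstraints

/-! ### Martingale noise -/

section FreshSamples

variable {Ω S Ξ : Type*} {m : MeasurableSpace Ω} [mΩ : MeasurableSpace Ω] [MeasurableSpace S]
  [MeasurableSpace Ξ] {μ : Measure Ω}

theorem integral_comp_prodMk_eq_zero [IsFiniteMeasure μ] {U : Ω → S} {ζ : Ω → Ξ}
    (hU : Measurable U) (hζ : Measurable ζ) (hind : IndepFun U ζ μ) {h : S × Ξ → ℝ}
    (hh : Measurable h) (hzero : ∀ u, ∫ s, h (u, s) ∂(μ.map ζ) = 0) :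
    ∫ ω, h (U ω, ζ ω) ∂μ = 0 := by
  by_cases hint : Integrable (fun ω => h (U ω, ζ ω)) μ
  · have hlaw := (indepFun_iff_map_prod_eq_prod_map_map hU.aemeasurable hζ.aemeasurable).1 hind
    have hpair : AEMeasurable (fun ω => (U ω, ζ ω)) μ := (hU.prodMk hζ).aemeasurable
    rw [← integral_map (f := h) hpair hh.aestronglyMeasurable, hlaw, integral_prod _ (by
      rwa [← hlaw, integrable_map_measure hh.aestronglyMeasurable hpair])]
    simp only [hzero, integral_zero]
  · exact integral_undef hint

theorem condExp_comp_prodMk_eq_zero [IsFiniteMeasure μ] (hm : m ≤ mΩ)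
    {U : Ω → S} (hU : Measurable[m] U) {ζ : Ω → Ξ} (hζ : Measurable ζ)
    (hind : Indep (MeasurableSpace.comap ζ inferInstance) m μ) {h : S × Ξ → ℝ} (hh : Measurable h)
    (hzero : ∀ u, ∫ s, h (u, s) ∂(μ.map ζ) = 0) (hint : Integrable (fun ω => h (U ω, ζ ω)) μ) :
    μ[fun ω => h (U ω, ζ ω) | m] =ᵐ[μ] 0 := by
  refine (ae_eq_condExp_of_forall_setIntegral_eq hm hint (fun s _ _ => integrableOn_zero)
    (fun s hs _ => ?_) stronglyMeasurable_zero.aestronglyMeasurable).symm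
  have hW : Measurable[m] fun ω => (s.indicator (fun _ => (1 : ℝ)) ω, U ω) :=
    (measurable_const.indicator hs).prodMk hU
  have hzero' := integral_comp_prodMk_eq_zero (hW.mono hm le_rfl) hζ
    (indep_of_indep_of_le_right hind hW.comap_le).symm
    (h := fun q : (ℝ × S) × Ξ => q.1.1 * h (q.1.2, q.2)) (by fun_prop)
    (fun u => by simp only [integral_const_mul, hzero, mul_zero])
  simp only [integral_zero]
  rw [← integral_indicator (hm s hs), ← hzero']
  congr 1 with ω
  by_cases hω : ω ∈ s <;> simp [hω]

theorem integral_sq_sum_eq_sum_integral_sq [IsFiniteMeasure μ] {𝒢 : Filtration ℕ mΩ}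
    {D : ℕ → Ω → ℝ} (hD : ∀ k, StronglyMeasurable[𝒢 (k + 1)] (D k)) (hL2 : ∀ k, MemLp (D k) 2 μ)
    (hcond : ∀ k, μ[D k | 𝒢 k] =ᵐ[μ] 0) (n : ℕ) :
    ∫ ω, (∑ k ∈ Finset.range n, D k ω) ^ 2 ∂μ = ∑ k ∈ Finset.range n, ∫ ω, D k ω ^ 2 ∂μ := by
  induction n with
  | zero => simp
  | succ n ih =>
    let T : Ω → ℝ := fun ω => ∑ k ∈ Finset.range n, D k ω
    have hT : StronglyMeasurable[𝒢 n] T := Finset.stronglyMeasurable_fun_sum _ fun k hk =>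
      (hD k).mono (𝒢.mono (Finset.mem_range.1 hk))
    have hT2 : MemLp T 2 μ := memLp_finsetSum _ fun k _ => hL2 k
    have hTD : Integrable (T * D n) μ := hT2.integrable_mul (hL2 n)
    have horth : ∫ ω, T ω * D n ω ∂μ = 0 := by
      change ∫ ω, (T * D n) ω ∂μ = 0
      rw [← integral_condExp (𝒢.le n)]
      refine integral_eq_zero_of_ae ?_
      filter_upwards [condExp_mul_of_stronglyMeasurable_left hT hTD
        ((hL2 n).integrable one_le_two), hcond n] with ω hpull hω
      rw [hpull, Pi.mul_apply, hω, Pi.zero_apply, mul_zero]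
    have hexp (ω : Ω) : (∑ k ∈ Finset.range (n + 1), D k ω) ^ 2 =
        T ω ^ 2 + 2 * (T ω * D n ω) + D n ω ^ 2 := by rw [Finset.sum_range_succ]; ring
    have hT2D : Integrable (fun ω => 2 * (T ω * D n ω)) μ := hTD.const_mul 2
    have hsq : Integrable (fun ω => T ω ^ 2 + 2 * (T ω * D n ω)) μ := hT2.integrable_sq.add hT2D
    simp only [hexp]
    rw [integral_add hsq (hL2 n).integrable_sq,
      integral_add hT2.integrable_sq hT2D, integral_const_mul, horth, ih, mul_zero, add_zero,
      Finset.sum_range_succ]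

theorem martingale_sum_of_condExp_eq_zero [IsFiniteMeasure μ] {𝒢 : Filtration ℕ mΩ}
    {D : ℕ → Ω → ℝ} (hD : ∀ k, StronglyMeasurable[𝒢 (k + 1)] (D k))
    (hint : ∀ k, Integrable (D k) μ) (hcond : ∀ k, μ[D k | 𝒢 k] =ᵐ[μ] 0) :
    Martingale (fun n ω => ∑ k ∈ Finset.range n, D k ω) 𝒢 μ := by
  refine martingale_of_condExp_sub_eq_zero_nat (fun n => Finset.stronglyMeasurable_fun_sum _
    fun k hk => (hD k).mono (𝒢.mono (Finset.mem_range.1 hk)))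
    (fun n => integrable_finsetSum _ fun k _ => hint k) fun n => ?_
  have hincr : ((fun ω => ∑ k ∈ Finset.range (n + 1), D k ω) -
      fun ω => ∑ k ∈ Finset.range n, D k ω) = D n := by
    ext ω; simp [Finset.sum_range_succ]
  rw [hincr]
  exact hcond n

theorem ae_exists_tendsto_sum_of_condExp_eq_zero [IsProbabilityMeasure μ] {𝒢 : Filtration ℕ mΩ}
    {D : ℕ → Ω → ℝ} (hD : ∀ k, StronglyMeasurable[𝒢 (k + 1)] (D k)) (hL2 : ∀ k, MemLp (D k) 2 μ)
    (hcond : ∀ k, μ[D k | 𝒢 k] =ᵐ[μ] 0) (hsum : Summable fun k => ∫ ω, D k ω ^ 2 ∂μ) :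
    ∀ᵐ ω ∂μ, ∃ l, Tendsto (fun n => ∑ k ∈ Finset.range n, D k ω) atTop (𝓝 l) := by
  have hint (k : ℕ) : Integrable (D k) μ := (hL2 k).integrable one_le_two
  refine (martingale_sum_of_condExp_eq_zero hD hint hcond).submartingale.exists_ae_tendsto_of_bdd
    (R := (1 + ∑' k, ∫ ω, D k ω ^ 2 ∂μ).toNNReal) fun n => ?_
  have hT2 : MemLp (fun ω => ∑ k ∈ Finset.range n, D k ω) 2 μ := memLp_finsetSum _ fun k _ => hL2 k
  have hT := hT2.integrable one_le_two
  rw [eLpNorm_one_eq_lintegral_enorm, ← ofReal_integral_norm_eq_lintegral_enorm hT]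
  refine ENNReal.ofReal_le_ofReal ?_
  calc ∫ ω, ‖∑ k ∈ Finset.range n, D k ω‖ ∂μ
      ≤ ∫ ω, (1 + (∑ k ∈ Finset.range n, D k ω) ^ 2) ∂μ := by
        refine integral_mono hT.norm ((integrable_const 1).add hT2.integrable_sq) fun ω => ?_
        simp only [Real.norm_eq_abs]
        rw [← sq_abs]
        nlinarith [sq_nonneg (|∑ k ∈ Finset.range n, D k ω| - 1)]
    _ = 1 + ∑ k ∈ Finset.range n, ∫ ω, D k ω ^ 2 ∂μ := by
        rw [integral_add (integrable_const 1) hT2.integrable_sq,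
          integral_sq_sum_eq_sum_integral_sq hD hL2 hcond, integral_const, probReal_univ, one_smul]
    _ ≤ _ := by
        gcongr
        exact hsum.sum_le_tsum _ fun k _ => integral_nonneg fun ω => sq_nonneg _

theorem ae_summable_of_summable_integral {f : ℕ → Ω → ℝ} (hf : ∀ k ω, 0 ≤ f k ω)
    (hint : ∀ k, Integrable (f k) μ) (hsum : Summable fun k => ∫ ω, f k ω ∂μ) :
    ∀ᵐ ω ∂μ, Summable fun k => f k ω := by
  have hmeas (k : ℕ) : AEMeasurable (fun ω => ENNReal.ofReal (f k ω)) μ :=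
    (hint k).aestronglyMeasurable.aemeasurable.ennreal_ofReal
  have hlintegral : ∫⁻ ω, ∑' k, ENNReal.ofReal (f k ω) ∂μ ≠ ⊤ := by
    rw [lintegral_tsum hmeas]
    simpa only [ofReal_integral_eq_lintegral_ofReal (hint _) (Eventually.of_forall (hf _))]
      using hsum.tsum_ofReal_ne_top
  filter_upwards [ae_lt_top' (AEMeasurable.tsum hmeas) hlintegral] with ω hω
  simpa only [ENNReal.toReal_ofReal (hf _ ω)] using ENNReal.summable_toReal hω.ne

/-- Samples `ζ k` of common law `ν`, each revealed at time `k + 1` of the filtration `𝒢` and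
independent of everything known at time `k`. -/
structure IsFresh (μ : Measure Ω) (𝒢 : Filtration ℕ mΩ) (ζ : ℕ → Ω → Ξ) (ν : Measure Ξ) :
    Prop where
  adapted : ∀ k, Measurable[𝒢 (k + 1)] (ζ k)
  law : ∀ k, μ.map (ζ k) = ν
  indep : ∀ k, Indep (MeasurableSpace.comap (ζ k) inferInstance) (𝒢 k) μ

namespace IsFresh

variable {𝒢 : Filtration ℕ mΩ} {ζ : ℕ → Ω → Ξ} {ν : Measure Ξ}

theorem measurable (hζ : IsFresh μ 𝒢 ζ ν) (k : ℕ) : Measurable (ζ k) :=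
  (hζ.adapted k).mono (𝒢.le _) le_rfl

theorem measurePreserving (hζ : IsFresh μ 𝒢 ζ ν) (k : ℕ) : MeasurePreserving (ζ k) μ ν :=
  ⟨hζ.measurable k, hζ.law k⟩

theorem isProbabilityMeasure [IsProbabilityMeasure μ] (hζ : IsFresh μ 𝒢 ζ ν) :
    IsProbabilityMeasure ν :=
  hζ.law 0 ▸ Measure.isProbabilityMeasure_map (hζ.measurable 0).aemeasurable

theorem memLp_of_norm_le {E : Type*} [NormedAddCommGroup E] (hζ : IsFresh μ 𝒢 ζ ν) {Λ : Ξ → ℝ}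
    (hΛ : MemLp Λ 2 ν) {k : ℕ} {u : Ω → E} (hu : AEStronglyMeasurable u μ)
    (hle : ∀ ω, ‖u ω‖ ≤ Λ (ζ k ω)) : MemLp u 2 μ :=
  (hΛ.comp_measurePreserving (hζ.measurePreserving k)).mono' hu (Eventually.of_forall hle)

theorem integral_norm_sq_le {E : Type*} [NormedAddCommGroup E] (hζ : IsFresh μ 𝒢 ζ ν) {Λ : Ξ → ℝ}
    (hΛ : MemLp Λ 2 ν) {k : ℕ} {u : Ω → E} (hle : ∀ ω, ‖u ω‖ ≤ Λ (ζ k ω)) :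
    ∫ ω, ‖u ω‖ ^ 2 ∂μ ≤ ∫ s, Λ s ^ 2 ∂ν := by
  have hmp := hζ.measurePreserving k
  rw [← hmp.map_eq, integral_map hmp.aemeasurable
    (by rw [hmp.map_eq]; exact hΛ.aestronglyMeasurable.pow 2)]
  exact integral_mono_of_nonneg (Eventually.of_forall fun ω => sq_nonneg _)
    (hΛ.comp_measurePreserving hmp).integrable_sq
    (Eventually.of_forall fun ω => pow_le_pow_left₀ (norm_nonneg _) (hle ω) 2)

theorem ae_exists_tendsto_sum [IsProbabilityMeasure μ] (hζ : IsFresh μ 𝒢 ζ ν) {U : ℕ → Ω → S}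
    (hU : ∀ k, Measurable[𝒢 k] (U k)) {h : S × Ξ → ℝ} (hh : Measurable h)
    (hzero : ∀ u, ∫ s, h (u, s) ∂ν = 0) {Λ : Ξ → ℝ} (hΛ : MemLp Λ 2 ν)
    (hle : ∀ u s, |h (u, s)| ≤ Λ s) {a : ℕ → ℝ} (ha : Summable fun k => a k ^ 2) :
    ∀ᵐ ω ∂μ, ∃ l,
      Tendsto (fun n => ∑ k ∈ Finset.range n, a k * h (U k ω, ζ k ω)) atTop (𝓝 l) := by
  have hmeas (k : ℕ) : Measurable[𝒢 (k + 1)] fun ω => h (U k ω, ζ k ω) :=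
    hh.comp (((hU k).mono (𝒢.mono k.le_succ) le_rfl).prodMk (hζ.adapted k))
  have hL2 (k : ℕ) : MemLp (fun ω => h (U k ω, ζ k ω)) 2 μ :=
    hζ.memLp_of_norm_le hΛ ((hmeas k).mono (𝒢.le _) le_rfl).aestronglyMeasurable fun ω => hle _ _
  refine ae_exists_tendsto_sum_of_condExp_eq_zero (𝒢 := 𝒢)
    (fun k => ((hmeas k).const_mul (a k)).stronglyMeasurable) (fun k => (hL2 k).const_mul (a k))
    (fun k => ?_) ?_
  · exact condExp_comp_prodMk_eq_zero (𝒢.le k) (hU k) (hζ.measurable k) (hζ.indep k)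
      (h := fun q => a k * h q) (hh.const_mul _)
      (fun u => by rw [hζ.law, integral_const_mul, hzero, mul_zero])
      (((hL2 k).integrable one_le_two).const_mul _)
  · simp only [mul_pow, integral_const_mul]
    refine Summable.of_nonneg_of_le
      (fun k => mul_nonneg (sq_nonneg _) (integral_nonneg fun ω => sq_nonneg _))
      (fun k => mul_le_mul_of_nonneg_left ?_ (sq_nonneg _)) (ha.mul_right (∫ s, Λ s ^ 2 ∂ν))
    simpa only [Real.norm_eq_abs, sq_abs] using
      hζ.integral_norm_sq_le hΛ (k := k) (u := fun ω => h (U k ω, ζ k ω)) fun ω => hle _ _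

end IsFresh

end FreshSamples

section VectorNoise

variable {Ω S Ξ E : Type*} [mΩ : MeasurableSpace Ω] [MeasurableSpace S] [MeasurableSpace Ξ]
  [NormedAddCommGroup E] [InnerProductSpace ℝ E]
  {μ : Measure Ω} [IsProbabilityMeasure μ] {𝒢 : Filtration ℕ mΩ} {ζ : ℕ → Ω → Ξ} {ν : Measure Ξ}

theorem exists_tendsto_of_forall_exists_tendsto_inner {ι : Type*} [Fintype ι]
    (b : OrthonormalBasis ι ℝ E) {v : ℕ → E}
    (h : ∀ i, ∃ l, Tendsto (fun n => ⟪v n, b i⟫) atTop (𝓝 l)) : ∃ l, Tendsto v atTop (𝓝 l) := by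
  choose l hl using h
  refine ⟨∑ i, l i • b i,
    (tendsto_finsetSum _ fun i _ => (hl i).smul_const (b i)).congr fun n => ?_⟩
  simp only [real_inner_comm (b _), b.sum_repr']

variable [FiniteDimensional ℝ E] [MeasurableSpace E] [BorelSpace E]

namespace IsFresh

/-- The test vector `Y` may depend on the state: weighing the noise by a bounded function of the
state avoids any moment assumption on the state. -/
theorem ae_exists_tendsto_sum_inner (hζ : IsFresh μ 𝒢 ζ ν) {U : ℕ → Ω → S}
    (hU : ∀ k, Measurable[𝒢 k] (U k)) {g : S → Ξ → E} (hg : Measurable fun q : S × Ξ => g q.1 q.2)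
    {Λ : Ξ → ℝ} (hΛ : MemLp Λ 2 ν) (hle : ∀ u s, ‖g u s‖ ≤ Λ s) {Y : S → E} (hY : Measurable Y)
    (hY1 : ∀ u, ‖Y u‖ ≤ 1) {a : ℕ → ℝ} (ha : Summable fun k => a k ^ 2) :
    ∀ᵐ ω ∂μ, ∃ l, Tendsto (fun n => ∑ k ∈ Finset.range n,
      a k * ⟪g (U k ω) (ζ k ω) - ∫ s, g (U k ω) s ∂ν, Y (U k ω)⟫) atTop (𝓝 l) := by
  have := hζ.isProbabilityMeasure
  have hmean : Measurable fun u => ∫ s, g u s ∂ν :=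
    hg.stronglyMeasurable.integral_prod_right'.measurable
  have hint (u : S) : Integrable (g u) ν := (hΛ.integrable one_le_two).mono'
    (hg.comp measurable_prodMk_left).aestronglyMeasurable (Eventually.of_forall (hle u))
  have hcent (u : S) : Integrable (fun s => g u s - ∫ s, g u s ∂ν) ν :=
    (hint u).sub (integrable_const _)
  refine hζ.ae_exists_tendsto_sum hU
    (h := fun q : S × Ξ => ⟪g q.1 q.2 - ∫ s, g q.1 s ∂ν, Y q.1⟫) ?_ (fun u => ?_)
    (Λ := fun s => Λ s + ∫ s, Λ s ∂ν) (hΛ.add (memLp_const _)) (fun u s => ?_) ha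
  · exact (hg.sub (hmean.comp measurable_fst)).inner (hY.comp measurable_fst)
  · simp only [real_inner_comm (Y u)]
    rw [integral_inner (hcent u),
      integral_sub (hint u) (integrable_const _), integral_const, probReal_univ, one_smul,
      sub_self, inner_zero_right]
  · calc |⟪g u s - ∫ s, g u s ∂ν, Y u⟫| ≤ ‖g u s - ∫ s, g u s ∂ν‖ * ‖Y u‖ :=
          abs_real_inner_le_norm _ _
      _ ≤ ‖g u s - ∫ s, g u s ∂ν‖ := mul_le_of_le_one_right (norm_nonneg _) (hY1 u)
      _ ≤ Λ s + ∫ s, Λ s ∂ν := (norm_sub_le _ _).trans (add_le_add (hle u s)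
          (norm_integral_le_of_norm_le (hΛ.integrable one_le_two) (Eventually.of_forall (hle u))))

theorem ae_exists_tendsto_sum_smul (hζ : IsFresh μ 𝒢 ζ ν) {U : ℕ → Ω → S}
    (hU : ∀ k, Measurable[𝒢 k] (U k)) {g : S → Ξ → E} (hg : Measurable fun q : S × Ξ => g q.1 q.2)
    {Λ : Ξ → ℝ} (hΛ : MemLp Λ 2 ν) (hle : ∀ u s, ‖g u s‖ ≤ Λ s)
    {a : ℕ → ℝ} (ha : Summable fun k => a k ^ 2) :
    ∀ᵐ ω ∂μ, ∃ l, Tendsto (fun n => ∑ k ∈ Finset.range n,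
      a k • (g (U k ω) (ζ k ω) - ∫ s, g (U k ω) s ∂ν)) atTop (𝓝 l) := by
  have hcoord := ae_all_iff.2 fun i => hζ.ae_exists_tendsto_sum_inner hU hg hΛ hle
    (Y := fun _ => stdOrthonormalBasis ℝ E i) measurable_const (fun _ => by simp) ha
  filter_upwards [hcoord] with ω hω
  exact exists_tendsto_of_forall_exists_tendsto_inner (stdOrthonormalBasis ℝ E)
    (by simpa only [sum_inner, real_inner_smul_left] using hω)

end IsFresh

end VectorNoise

/-! ### Averaging -/

section Mean

variable {m : ℕ} {E : Type*} [NormedAddCommGroup E] [InnerProductSpace ℝ E]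

/-- The mean `(v_1 + ⋯ + v_m) / m` of a finite family of vectors; it is `0` for `m = 0`. -/
noncomputable def mean (v : Fin m → E) : E := (m : ℝ)⁻¹ • ∑ j, v j

theorem mean_sub_smul (v u : Fin m → E) (a : ℝ) :
    mean (fun j => v j - a • u j) = mean v - a • mean u := by
  simp only [mean, Finset.sum_sub_distrib, ← Finset.smul_sum, smul_sub]
  rw [smul_comm]

theorem mean_sum_smul {A : Matrix (Fin m) (Fin m) ℝ} (hA : A ∈ doublyStochastic ℝ (Fin m))
    (v : Fin m → E) : mean (fun j => ∑ i, A j i • v i) = mean v := by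
  unfold mean
  rw [Finset.sum_comm]
  simp only [← Finset.sum_smul, sum_col_of_mem_doublyStochastic hA, one_smul]

theorem sum_sub_mean (hm : 0 < m) (v : Fin m → E) : ∑ j, (v j - mean v) = 0 := by
  rw [Finset.sum_sub_distrib, Finset.sum_const, Finset.card_univ, Fintype.card_fin, mean,
    ← Nat.cast_smul_eq_nsmul ℝ, smul_inv_smul₀ (Nat.cast_ne_zero.2 hm.ne'), sub_self]

theorem sum_norm_sq_eq_add_mean (hm : 0 < m) (v : Fin m → E) :
    ∑ j, ‖v j‖ ^ 2 = ∑ j, ‖v j - mean v‖ ^ 2 + m * ‖mean v‖ ^ 2 := by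
  have hsplit (j : Fin m) :
      ‖v j‖ ^ 2 = ‖v j - mean v‖ ^ 2 + 2 * ⟪v j - mean v, mean v⟫ + ‖mean v‖ ^ 2 := by
    rw [← norm_add_sq_real, sub_add_cancel]
  simp only [hsplit, Finset.sum_add_distrib, ← Finset.mul_sum, ← sum_inner, sum_sub_mean hm,
    inner_zero_left, mul_zero, add_zero, Finset.sum_const, Finset.card_univ, Fintype.card_fin,
    nsmul_eq_mul]

theorem sum_norm_sub_mean_sq_le (hm : 0 < m) (v : Fin m → E) :
    ∑ j, ‖v j - mean v‖ ^ 2 ≤ ∑ j, ‖v j‖ ^ 2 := by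
  rw [sum_norm_sq_eq_add_mean hm v]
  exact le_add_of_nonneg_right (by positivity)

theorem norm_mean_sq_le (hm : 0 < m) (v : Fin m → E) :
    ‖mean v‖ ^ 2 ≤ (m : ℝ)⁻¹ * ∑ j, ‖v j‖ ^ 2 := by
  rw [sum_norm_sq_eq_add_mean hm v, mul_add,
    inv_mul_cancel_left₀ (Nat.cast_ne_zero.2 hm.ne')]
  exact le_add_of_nonneg_left (by positivity)

theorem sub_mean_of_step {A : Matrix (Fin m) (Fin m) ℝ} (hA : A ∈ doublyStochastic ℝ (Fin m))
    {y y' u : Fin m → E} {a : ℝ} (h : ∀ j, y' j = ∑ i, A j i • y i - a • u j) (j : Fin m) :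
    y' j - mean y' = ∑ i, A j i • (y i - mean y) - a • (u j - mean u) := by
  have hmean : mean y' = mean y - a • mean u := by
    rw [funext h, mean_sub_smul, mean_sum_smul hA]
  simp only [hmean, h j, smul_sub, Finset.sum_sub_distrib, ← Finset.sum_smul,
    sum_row_of_mem_doublyStochastic hA, one_smul]
  abel

end Mean

/-! ### Contraction of the disagreement -/

section Contraction

variable {m : ℕ} {E : Type*} [NormedAddCommGroup E] [InnerProductSpace ℝ E]

theorem disagreement_apply {A : Matrix (Fin m) (Fin m) ℝ} (hA : A ∈ doublyStochastic ℝ (Fin m))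
    (i i' : Fin m) : disagreement A i i' = ∑ j, A j i * A j i' - (m : ℝ)⁻¹ := by
  have havg : Aᵀ * averaging m * A = averaging m := by
    ext k l
    simp only [Matrix.mul_apply, averaging, Matrix.of_apply, Matrix.transpose_apply,
      ← Finset.sum_mul, sum_col_of_mem_doublyStochastic hA, one_mul, ← Finset.mul_sum, mul_one]
  rw [disagreement, Matrix.mul_sub, Matrix.sub_mul, mul_one, havg]
  simp [Matrix.mul_apply, averaging]

theorem abs_disagreement_le {A : Matrix (Fin m) (Fin m) ℝ} (hA : A ∈ doublyStochastic ℝ (Fin m))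
    (i i' : Fin m) : |disagreement A i i'| ≤ m + (m : ℝ)⁻¹ := by
  have hentry (j : Fin m) : |A j i * A j i'| ≤ 1 := by
    rw [abs_mul, abs_of_nonneg (nonneg_of_mem_doublyStochastic hA),
      abs_of_nonneg (nonneg_of_mem_doublyStochastic hA)]
    exact mul_le_one₀ (le_one_of_mem_doublyStochastic hA) (nonneg_of_mem_doublyStochastic hA)
      (le_one_of_mem_doublyStochastic hA)
  rw [disagreement_apply hA]
  refine (abs_sub _ _).trans (add_le_add ?_ (abs_of_nonneg (by positivity)).le)
  calc |∑ j, A j i * A j i'| ≤ ∑ j, |A j i * A j i'| := Finset.abs_sum_le_sum_abs _ _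
    _ ≤ ∑ _j : Fin m, 1 := Finset.sum_le_sum fun j _ => hentry j
    _ = m := by simp

theorem sum_norm_sum_smul_sq {A : Matrix (Fin m) (Fin m) ℝ} (hA : A ∈ doublyStochastic ℝ (Fin m))
    {v : Fin m → E} (hv : ∑ i, v i = 0) :
    ∑ j, ‖∑ i, A j i • v i‖ ^ 2 = ∑ i, ∑ i', disagreement A i i' * ⟪v i, v i'⟫ := by
  have hconst : ∑ i, ∑ i', (m : ℝ)⁻¹ * ⟪v i, v i'⟫ = 0 := by
    simp only [← Finset.mul_sum, ← inner_sum, hv, inner_zero_right, mul_zero,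
      Finset.sum_const_zero]
  simp only [disagreement_apply hA, sub_mul, Finset.sum_sub_distrib, hconst, sub_zero]
  simp only [← real_inner_self_eq_norm_sq, sum_inner, inner_sum, real_inner_smul_left,
    real_inner_smul_right, Finset.sum_mul]
  rw [Finset.sum_comm]
  refine Finset.sum_congr rfl fun i _ => ?_
  rw [Finset.sum_comm]
  refine Finset.sum_congr rfl fun i' _ => Finset.sum_congr rfl fun j _ => ?_
  rw [real_inner_comm]
  ring

variable [FiniteDimensional ℝ E]

theorem sum_mul_inner_le (M : Matrix (Fin m) (Fin m) ℝ) (v : Fin m → E) :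
    ∑ i, ∑ i', M i i' * ⟪v i, v i'⟫ ≤
      ‖Matrix.toEuclideanCLM (𝕜 := ℝ) (n := Fin m) M‖ * ∑ i, ‖v i‖ ^ 2 := by
  let b := stdOrthonormalBasis ℝ E
  let T := Matrix.toEuclideanCLM (𝕜 := ℝ) (n := Fin m) M
  let x : Fin (Module.finrank ℝ E) → Vec m := fun l => WithLp.toLp 2 fun i => ⟪v i, b l⟫
  have hinner (i i' : Fin m) : ⟪v i, v i'⟫ = ∑ l, ⟪v i, b l⟫ * ⟪v i', b l⟫ := by
    simp only [real_inner_comm (b _) (v i'), b.sum_inner_mul_inner]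
  have hquad : ∑ i, ∑ i', M i i' * ⟪v i, v i'⟫ = ∑ l, ⟪x l, T (x l)⟫ := by
    simp only [T, x, PiLp.inner_apply, Matrix.ofLp_toEuclideanCLM, Matrix.mulVec, dotProduct,
      RCLike.inner_apply, conj_trivial, Finset.sum_mul, hinner, Finset.mul_sum]
    rw [Finset.sum_comm (s := (Finset.univ : Finset (Fin (Module.finrank ℝ E))))]
    refine Finset.sum_congr rfl fun i _ => ?_
    rw [Finset.sum_comm]
    refine Finset.sum_congr rfl fun l _ => Finset.sum_congr rfl fun i' _ => ?_
    ring
  have hnorm : ∑ i, ‖v i‖ ^ 2 = ∑ l, ‖x l‖ ^ 2 := by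
    simp only [x, EuclideanSpace.norm_sq_eq, ← b.sum_sq_norm_inner_left]
    rw [Finset.sum_comm]
  rw [hquad, hnorm, Finset.mul_sum]
  refine Finset.sum_le_sum fun l _ => ?_
  calc ⟪x l, T (x l)⟫ ≤ ‖x l‖ * ‖T (x l)‖ := real_inner_le_norm _ _
    _ ≤ ‖x l‖ * (‖T‖ * ‖x l‖) := by gcongr; exact T.le_opNorm _
    _ = ‖T‖ * ‖x l‖ ^ 2 := by ring

end Contraction

section RandomWeights

variable {m : ℕ} {Ω E : Type*} {𝓂 : MeasurableSpace Ω} [mΩ : MeasurableSpace Ω] {μ : Measure Ω}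
  [NormedAddCommGroup E] [InnerProductSpace ℝ E]

theorem measurable_entry (i j : Fin m) : Measurable fun A : Matrix (Fin m) (Fin m) ℝ => A i j :=
  (measurable_pi_apply j).comp (measurable_pi_apply (X := fun _ : Fin m => Fin m → ℝ) i)

theorem measurable_disagreement (i j : Fin m) :
    Measurable fun A : Matrix (Fin m) (Fin m) ℝ => disagreement A i j := by
  simp only [disagreement, Matrix.mul_apply, Matrix.transpose_apply]
  exact Finset.measurable_sum _ fun k _ => (Finset.measurable_sum _ fun l _ =>
    (measurable_entry _ _).mul measurable_const).mul (measurable_entry _ _)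

theorem mixingNorm_eq_of_identDistrib {A A' : Ω → Matrix (Fin m) (Fin m) ℝ}
    (h : IdentDistrib A A' μ μ) : mixingNorm μ A = mixingNorm μ A' := by
  have hentry (i j : Fin m) :
      ∫ ω, disagreement (A ω) i j ∂μ = ∫ ω, disagreement (A' ω) i j ∂μ :=
    (h.comp (measurable_disagreement i j)).integral_eq
  simp only [mixingNorm, hentry]

theorem integrable_disagreement [IsFiniteMeasure μ] {A : Ω → Matrix (Fin m) (Fin m) ℝ}
    (hA : Measurable A) (hst : ∀ᵐ ω ∂μ, A ω ∈ doublyStochastic ℝ (Fin m)) (i i' : Fin m) :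
    Integrable (fun ω => disagreement (A ω) i i') μ := by
  refine Integrable.of_bound ((measurable_disagreement i i').comp hA).aestronglyMeasurable
    (m + (m : ℝ)⁻¹) ?_
  filter_upwards [hst] with ω hω using abs_disagreement_le hω i i'

theorem integrable_inner_of_memLp {v w : Ω → E} (hv : MemLp v 2 μ) (hw : MemLp w 2 μ) :
    Integrable (fun ω => ⟪v ω, w ω⟫) μ :=
  (hv.norm.integrable_mul hw.norm).mono' (hv.aestronglyMeasurable.inner hw.aestronglyMeasurable)
    (Eventually.of_forall fun _ => norm_inner_le_norm _ _)

variable [FiniteDimensional ℝ E] [MeasurableSpace E] [BorelSpace E]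

theorem integral_sum_norm_sum_smul_sq_eq [IsProbabilityMeasure μ]
    {A : Ω → Matrix (Fin m) (Fin m) ℝ} (hA : Measurable A)
    (hst : ∀ᵐ ω ∂μ, A ω ∈ doublyStochastic ℝ (Fin m))
    (hind : Indep (MeasurableSpace.comap A inferInstance) 𝓂 μ) {v : Fin m → Ω → E}
    (hv : ∀ i, Measurable[𝓂] (v i)) (hv2 : ∀ i, MemLp (v i) 2 μ) (hv0 : ∀ ω, ∑ i, v i ω = 0) :
    ∫ ω, ∑ j, ‖∑ i, A ω j i • v i ω‖ ^ 2 ∂μ =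
      ∑ i, ∑ i', (∫ ω, disagreement (A ω) i i' ∂μ) * ∫ ω, ⟪v i ω, v i' ω⟫ ∂μ := by
  have hD (i i' : Fin m) := integrable_disagreement hA hst i i'
  have hinner (i i' : Fin m) := integrable_inner_of_memLp (hv2 i) (hv2 i')
  have hIF (i i' : Fin m) :
      IndepFun (fun ω => disagreement (A ω) i i') (fun ω => ⟪v i ω, v i' ω⟫) μ :=
    indep_of_indep_of_le_right (indep_of_indep_of_le_left hind
      ((measurable_disagreement i i').comp (comap_measurable A)).comap_le)
      ((hv i).inner (hv i')).comap_le
  have hprod (i i' : Fin m) : Integrable (fun ω => disagreement (A ω) i i' * ⟪v i ω, v i' ω⟫) μ :=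
    (hIF i i').integrable_mul (hD i i') (hinner i i')
  calc ∫ ω, ∑ j, ‖∑ i, A ω j i • v i ω‖ ^ 2 ∂μ
      = ∫ ω, ∑ i, ∑ i', disagreement (A ω) i i' * ⟪v i ω, v i' ω⟫ ∂μ := by
        refine integral_congr_ae ?_
        filter_upwards [hst] with ω hω using sum_norm_sum_smul_sq hω (hv0 ω)
    _ = ∑ i, ∑ i', ∫ ω, disagreement (A ω) i i' * ⟪v i ω, v i' ω⟫ ∂μ := by
        rw [integral_finsetSum _ fun i _ => integrable_finsetSum _ fun i' _ => hprod i i']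
        exact Finset.sum_congr rfl fun i _ => integral_finsetSum _ fun i' _ => hprod i i'
    _ = _ := Finset.sum_congr rfl fun i _ => Finset.sum_congr rfl fun i' _ =>
        (hIF i i').integral_fun_mul_eq_mul_integral (hD i i').aestronglyMeasurable
          (hinner i i').aestronglyMeasurable

theorem integral_sum_norm_sum_smul_sq_le [IsProbabilityMeasure μ]
    {A : Ω → Matrix (Fin m) (Fin m) ℝ} (hA : Measurable A)
    (hst : ∀ᵐ ω ∂μ, A ω ∈ doublyStochastic ℝ (Fin m))
    (hind : Indep (MeasurableSpace.comap A inferInstance) 𝓂 μ) {v : Fin m → Ω → E}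
    (hv : ∀ i, Measurable[𝓂] (v i)) (hv2 : ∀ i, MemLp (v i) 2 μ) (hv0 : ∀ ω, ∑ i, v i ω = 0) :
    ∫ ω, ∑ j, ‖∑ i, A ω j i • v i ω‖ ^ 2 ∂μ ≤ mixingNorm μ A * ∫ ω, ∑ i, ‖v i ω‖ ^ 2 ∂μ := by
  let M : Matrix (Fin m) (Fin m) ℝ := Matrix.of fun i j => ∫ ω, disagreement (A ω) i j ∂μ
  have hterm (i i' : Fin m) : Integrable (fun ω => M i i' * ⟪v i ω, v i' ω⟫) μ :=
    (integrable_inner_of_memLp (hv2 i) (hv2 i')).const_mul _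
  have hsum (i : Fin m) : Integrable (fun ω => ∑ i', M i i' * ⟪v i ω, v i' ω⟫) μ :=
    integrable_finsetSum _ fun i' _ => hterm i i'
  have hsq : Integrable (fun ω => ∑ i, ‖v i ω‖ ^ 2) μ :=
    integrable_finsetSum _ fun i _ => (hv2 i).integrable_norm_pow two_ne_zero
  calc ∫ ω, ∑ j, ‖∑ i, A ω j i • v i ω‖ ^ 2 ∂μ
      = ∑ i, ∑ i', M i i' * ∫ ω, ⟪v i ω, v i' ω⟫ ∂μ :=
        integral_sum_norm_sum_smul_sq_eq hA hst hind hv hv2 hv0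
    _ = ∫ ω, ∑ i, ∑ i', M i i' * ⟪v i ω, v i' ω⟫ ∂μ := by
        rw [integral_finsetSum _ fun i _ => hsum i]
        simp only [integral_finsetSum _ fun i' _ => hterm _ i', integral_const_mul]
    _ ≤ ∫ ω, mixingNorm μ A * ∑ i, ‖v i ω‖ ^ 2 ∂μ :=
        integral_mono (integrable_finsetSum _ fun i _ => hsum i) (hsq.const_mul _)
          fun ω => sum_mul_inner_le M fun i => v i ω
    _ = _ := integral_const_mul _ _

end RandomWeights

/-! ### Consensus -/

theorem summable_of_le_mul_add {V c : ℕ → ℝ} {r : ℝ} (hr : r < 1) (hV : ∀ k, 0 ≤ V k)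
    (hc : Summable c) (hc0 : ∀ k, 0 ≤ c k) (h : ∀ k, V (k + 1) ≤ r * V k + c k) :
    Summable V := by
  refine summable_of_sum_range_le (c := (V 0 + ∑' k, c k) / (1 - r)) hV fun n => ?_
  have hshift : ∑ k ∈ Finset.range (n + 1), V k ≤
      V 0 + r * (∑ k ∈ Finset.range n, V k) + ∑ k ∈ Finset.range n, c k := by
    rw [Finset.sum_range_succ', Finset.mul_sum, add_comm, add_assoc, ← Finset.sum_add_distrib]
    gcongr with k _
    exact h k
  have htsum := hc.sum_le_tsum (Finset.range n) fun k _ => hc0 k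
  rw [Finset.sum_range_succ] at hshift
  rw [le_div_iff₀ (by linarith)]
  linarith [hV n]

theorem norm_add_sq_le_mul {E : Type*} [SeminormedAddCommGroup E] (x y : E) {η : ℝ} (hη : 0 < η) :
    ‖x + y‖ ^ 2 ≤ (1 + η) * ‖x‖ ^ 2 + (1 + η⁻¹) * ‖y‖ ^ 2 := by
  have hsq := pow_le_pow_left₀ (norm_nonneg _) (norm_add_le x y) 2
  have hyoung := two_mul_le_add_mul_sq (a := ‖x‖) (b := ‖y‖) hη
  linarith [add_sq ‖x‖ ‖y‖]

section Gossip

variable {m : ℕ} {Ω E : Type*} [NormedAddCommGroup E] [InnerProductSpace ℝ E]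

theorem norm_sub_mean_le_sum_norm (hm : 0 < m) (v : Fin m → E) (j : Fin m) :
    ‖v j - mean v‖ ≤ ∑ i, ‖v i‖ := by
  refine le_of_sq_le_sq ?_ (by positivity)
  calc ‖v j - mean v‖ ^ 2 ≤ ∑ i, ‖v i - mean v‖ ^ 2 :=
        Finset.single_le_sum (f := fun i => ‖v i - mean v‖ ^ 2) (fun _ _ => sq_nonneg _)
          (Finset.mem_univ j)
    _ ≤ ∑ i, ‖v i‖ ^ 2 := sum_norm_sub_mean_sq_le hm v
    _ ≤ (∑ i, ‖v i‖) ^ 2 := Finset.sum_sq_le_sq_sum_of_nonneg fun _ _ => norm_nonneg _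

theorem measurable_mean [MeasurableSpace E] [BorelSpace E] [SecondCountableTopology E]
    {𝓂 : MeasurableSpace Ω} {v : Fin m → Ω → E} (hv : ∀ j, Measurable[𝓂] (v j)) :
    Measurable[𝓂] fun ω => mean fun j => v j ω :=
  (Finset.measurable_sum _ fun j _ => hv j).const_smul _

variable [mΩ : MeasurableSpace Ω] {μ : Measure Ω}

/-- Random doubly stochastic weights, those of step `k` being independent of the past `𝒢 k`, whose
expected disagreement matrices have spectral norm at most `ρ`. -/
structure IsMixing (μ : Measure Ω) (𝒢 : Filtration ℕ mΩ) (A : ℕ → Ω → Matrix (Fin m) (Fin m) ℝ)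
    (ρ : ℝ) : Prop where
  measurable : ∀ k, Measurable (A k)
  stochastic : ∀ k, ∀ᵐ ω ∂μ, A k ω ∈ doublyStochastic ℝ (Fin m)
  indep : ∀ k, Indep (MeasurableSpace.comap (A k) inferInstance) (𝒢 k) μ
  mixingNorm_le : ∀ k, mixingNorm μ (A k) ≤ ρ

/-- The noisy averaging dynamics `y_{k+1,j} = ∑_i [A_k]_{ji} y_{k,i} - a_k u_{k,j}`, the states
being adapted to `𝒢`. -/
structure IsGossip [MeasurableSpace E] (μ : Measure Ω) (𝒢 : Filtration ℕ mΩ)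
    (A : ℕ → Ω → Matrix (Fin m) (Fin m) ℝ) (a : ℕ → ℝ) (u y : ℕ → Fin m → Ω → E) : Prop where
  adapted : ∀ k j, Measurable[𝒢 k] (y k j)
  step : ∀ k, ∀ᵐ ω ∂μ, ∀ j, y (k + 1) j ω = ∑ i, A k ω j i • y k i ω - a k • u k j ω

variable {𝒢 : Filtration ℕ mΩ} {A : ℕ → Ω → Matrix (Fin m) (Fin m) ℝ} {ρ : ℝ}

theorem IsMixing.memLp_sum_smul (hA : IsMixing μ 𝒢 A ρ) {v : Fin m → Ω → E}
    (hv : ∀ i, MemLp (v i) 2 μ) (k : ℕ) (j : Fin m) :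
    MemLp (fun ω => ∑ i, A k ω j i • v i ω) 2 μ := by
  refine memLp_finsetSum _ fun i _ => (hv i).mono
    (((measurable_entry j i).comp (hA.measurable k)).aestronglyMeasurable.smul
      (hv i).aestronglyMeasurable) ?_
  filter_upwards [hA.stochastic k] with ω hω
  rw [norm_smul, Real.norm_of_nonneg (nonneg_of_mem_doublyStochastic hω)]
  exact mul_le_of_le_one_left (norm_nonneg _) (le_one_of_mem_doublyStochastic hω)

variable [MeasurableSpace E] {a : ℕ → ℝ} {u y : ℕ → Fin m → Ω → E}

namespace IsGossip

theorem mean_step (hy : IsGossip μ 𝒢 A a u y) (hA : IsMixing μ 𝒢 A ρ) (k : ℕ) :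
    ∀ᵐ ω ∂μ, (mean fun j => y (k + 1) j ω) =
      (mean fun j => y k j ω) - a k • mean fun j => u k j ω := by
  filter_upwards [hy.step k, hA.stochastic k] with ω hstep hst
  rw [funext hstep, mean_sub_smul, mean_sum_smul hst]

theorem ae_sum_norm_sq_step_le (hy : IsGossip μ 𝒢 A a u y) {η : ℝ} (hη : 0 < η) (k : ℕ) :
    ∀ᵐ ω ∂μ, ∑ j, ‖y (k + 1) j ω‖ ^ 2 ≤ (1 + η) * ∑ j, ‖∑ i, A k ω j i • y k i ω‖ ^ 2
      + (1 + η⁻¹) * a k ^ 2 * ∑ j, ‖u k j ω‖ ^ 2 := by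
  filter_upwards [hy.step k] with ω hstep
  rw [Finset.mul_sum, Finset.mul_sum, ← Finset.sum_add_distrib]
  refine Finset.sum_le_sum fun j _ => ?_
  rw [hstep j, sub_eq_add_neg]
  refine (norm_add_sq_le_mul _ _ hη).trans_eq ?_
  rw [norm_neg, norm_smul, mul_pow, Real.norm_eq_abs, sq_abs, mul_assoc]

theorem memLp (hy : IsGossip μ 𝒢 A a u y) (hA : IsMixing μ 𝒢 A ρ)
    (hu : ∀ k j, MemLp (u k j) 2 μ) (hy0 : ∀ j, MemLp (y 0 j) 2 μ) (k : ℕ) (j : Fin m) :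
    MemLp (y k j) 2 μ := by
  induction k generalizing j with
  | zero => exact hy0 j
  | succ k ih =>
    refine ((hA.memLp_sum_smul ih k j).sub ((hu k j).const_smul (a k))).ae_eq ?_
    filter_upwards [hy.step k] with ω hstep using (hstep j).symm

variable [FiniteDimensional ℝ E] [BorelSpace E]

theorem smul_sub_mean (hy : IsGossip μ 𝒢 A a u y) (hA : IsMixing μ 𝒢 A ρ) {w : Ω → ℝ}
    (hw : Measurable[𝒢 0] w) :
    IsGossip μ 𝒢 A a (fun k j ω => w ω • (u k j ω - mean fun i => u k i ω))
      fun k j ω => w ω • (y k j ω - mean fun i => y k i ω) where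
  adapted k j := (hw.mono (𝒢.mono k.zero_le) le_rfl).smul
    ((hy.adapted k j).sub (measurable_mean (hy.adapted k)))
  step k := by
    filter_upwards [hy.step k, hA.stochastic k] with ω hstep hst j
    rw [sub_mean_of_step hst hstep j, smul_sub, Finset.smul_sum, smul_comm (w ω) (a k)]
    simp only [smul_comm (w ω)]

variable [IsProbabilityMeasure μ]

theorem integral_sum_norm_sq_step_le (hy : IsGossip μ 𝒢 A a u y) (hA : IsMixing μ 𝒢 A ρ)
    (hu : ∀ k j, MemLp (u k j) 2 μ) (hy0 : ∀ j, MemLp (y 0 j) 2 μ)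
    (hcent : ∀ k ω, ∑ j, y k j ω = 0) {η : ℝ} (hη : 0 < η) (k : ℕ) :
    ∫ ω, ∑ j, ‖y (k + 1) j ω‖ ^ 2 ∂μ ≤ (1 + η) * ρ * (∫ ω, ∑ j, ‖y k j ω‖ ^ 2 ∂μ)
      + (1 + η⁻¹) * a k ^ 2 * ∫ ω, ∑ j, ‖u k j ω‖ ^ 2 ∂μ := by
  have hsq {v : Fin m → Ω → E} (hv : ∀ j, MemLp (v j) 2 μ) :
      Integrable (fun ω => ∑ j, ‖v j ω‖ ^ 2) μ :=
    integrable_finsetSum _ fun j _ => (hv j).integrable_norm_pow two_ne_zero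
  have hy2 := hy.memLp hA hu hy0
  have hAy := (hsq (hA.memLp_sum_smul (hy2 k) k)).const_mul (1 + η)
  have hu2 := (hsq (hu k)).const_mul ((1 + η⁻¹) * a k ^ 2)
  have hcontract : ∫ ω, ∑ j, ‖∑ i, A k ω j i • y k i ω‖ ^ 2 ∂μ ≤
      ρ * ∫ ω, ∑ j, ‖y k j ω‖ ^ 2 ∂μ :=
    (integral_sum_norm_sum_smul_sq_le (hA.measurable k) (hA.stochastic k) (hA.indep k)
      (hy.adapted k) (hy2 k) (hcent k)).trans
      (mul_le_mul_of_nonneg_right (hA.mixingNorm_le k) (by positivity))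
  calc ∫ ω, ∑ j, ‖y (k + 1) j ω‖ ^ 2 ∂μ
      ≤ ∫ ω, ((1 + η) * ∑ j, ‖∑ i, A k ω j i • y k i ω‖ ^ 2
          + (1 + η⁻¹) * a k ^ 2 * ∑ j, ‖u k j ω‖ ^ 2) ∂μ :=
        integral_mono_ae (hsq (hy2 (k + 1))) (hAy.add hu2) (hy.ae_sum_norm_sq_step_le hη k)
    _ = (1 + η) * (∫ ω, ∑ j, ‖∑ i, A k ω j i • y k i ω‖ ^ 2 ∂μ)
          + (1 + η⁻¹) * a k ^ 2 * ∫ ω, ∑ j, ‖u k j ω‖ ^ 2 ∂μ := by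
        rw [integral_add hAy hu2, integral_const_mul, integral_const_mul]
    _ ≤ _ := by
        rw [mul_assoc (1 + η) ρ]
        gcongr

theorem summable_integral_sum_norm_sq (hy : IsGossip μ 𝒢 A a u y) (hA : IsMixing μ 𝒢 A ρ)
    (hρ : ρ < 1) (hu : ∀ k j, MemLp (u k j) 2 μ) (hy0 : ∀ j, MemLp (y 0 j) 2 μ)
    (hcent : ∀ k ω, ∑ j, y k j ω = 0) {G : ℝ} (hG : ∀ k, ∫ ω, ∑ j, ‖u k j ω‖ ^ 2 ∂μ ≤ G)
    (ha : Summable fun k => a k ^ 2) : Summable fun k => ∫ ω, ∑ j, ‖y k j ω‖ ^ 2 ∂μ := by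
  have hη : 0 < (1 - ρ) / 2 := by linarith
  have hG0 : 0 ≤ G := le_trans (by positivity) (hG 0)
  refine summable_of_le_mul_add (r := (1 + (1 - ρ) / 2) * ρ)
    (c := fun k => (1 + ((1 - ρ) / 2)⁻¹) * G * a k ^ 2) (by nlinarith) (fun k => by positivity)
    (ha.mul_left _) (fun k => by positivity) fun k => ?_
  refine (hy.integral_sum_norm_sq_step_le hA hu hy0 hcent hη k).trans ?_
  rw [mul_right_comm _ G]
  gcongr
  exact hG k

theorem ae_summable_sum_norm_sub_mean_sq_of_weight (hm : 0 < m) (hy : IsGossip μ 𝒢 A a u y)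
    (hA : IsMixing μ 𝒢 A ρ) (hρ : ρ < 1) (hu : ∀ k j, MemLp (u k j) 2 μ) {G : ℝ}
    (hG : ∀ k, ∫ ω, ∑ j, ‖u k j ω‖ ^ 2 ∂μ ≤ G) (ha : Summable fun k => a k ^ 2) {w : Ω → ℝ}
    (hw : Measurable[𝒢 0] w) (hw0 : ∀ ω, 0 < w ω) (hw1 : ∀ ω, w ω ≤ 1)
    (hy0 : ∀ j, MemLp (fun ω => w ω • (y 0 j ω - mean fun i => y 0 i ω)) 2 μ) :
    ∀ᵐ ω ∂μ, Summable fun k => ∑ j, ‖y k j ω - mean fun i => y k i ω‖ ^ 2 := by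
  have hwle (ω : Ω) (v : E) : ‖w ω • v‖ ≤ ‖v‖ := by
    rw [norm_smul, Real.norm_of_nonneg (hw0 ω).le]
    exact mul_le_of_le_one_left (norm_nonneg _) (hw1 ω)
  have hu' (k : ℕ) (j : Fin m) : MemLp (fun ω => w ω • (u k j ω - mean fun i => u k i ω)) 2 μ := by
    have hmean : MemLp (fun ω => mean fun i => u k i ω) 2 μ :=
      (memLp_finsetSum _ fun i _ => hu k i).const_smul _
    have hcent := (hu k j).sub hmean
    exact hcent.mono ((hw.mono (𝒢.le 0) le_rfl).aestronglyMeasurable.smul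
      hcent.aestronglyMeasurable) (Eventually.of_forall fun ω => hwle ω _)
  have hG' (k : ℕ) : ∫ ω, ∑ j, ‖w ω • (u k j ω - mean fun i => u k i ω)‖ ^ 2 ∂μ ≤ G := by
    refine (integral_mono_of_nonneg (Eventually.of_forall fun ω => by positivity)
      (integrable_finsetSum _ fun j _ => (hu k j).integrable_norm_pow two_ne_zero)
      (Eventually.of_forall fun ω => ?_)).trans (hG k)
    refine (Finset.sum_le_sum fun j _ => ?_).trans (sum_norm_sub_mean_sq_le hm fun i => u k i ω)
    exact pow_le_pow_left₀ (norm_nonneg _) (hwle ω _) 2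
  have hy' := hy.smul_sub_mean hA hw
  have hsum := hy'.summable_integral_sum_norm_sq hA hρ hu' hy0
    (fun k ω => by rw [← Finset.smul_sum, sum_sub_mean hm, smul_zero]) hG' ha
  filter_upwards [ae_summable_of_summable_integral (fun k ω => by positivity) (fun k =>
    integrable_finsetSum _ fun j _ => (hy'.memLp hA hu' hy0 k j).integrable_norm_pow two_ne_zero)
    hsum] with ω hω
  simp only [norm_smul, mul_pow, ← Finset.mul_sum] at hω
  exact (summable_mul_left_iff (pow_ne_zero 2 (norm_ne_zero_iff.2 (hw0 ω).ne'))).1 hω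

/-- Weighing the whole trajectory by the scalar `(1 + ∑_j ‖y_{0,j}‖)⁻¹` makes the initial state
bounded and preserves the dynamics, so no moment of the initial state is required. -/
theorem ae_summable_sum_norm_sub_mean_sq (hm : 0 < m) (hy : IsGossip μ 𝒢 A a u y)
    (hA : IsMixing μ 𝒢 A ρ) (hρ : ρ < 1) (hu : ∀ k j, MemLp (u k j) 2 μ) {G : ℝ}
    (hG : ∀ k, ∫ ω, ∑ j, ‖u k j ω‖ ^ 2 ∂μ ≤ G) (ha : Summable fun k => a k ^ 2) :
    ∀ᵐ ω ∂μ, Summable fun k => ∑ j, ‖y k j ω - mean fun i => y k i ω‖ ^ 2 := by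
  let w : Ω → ℝ := fun ω => (1 + ∑ j, ‖y 0 j ω‖)⁻¹
  have hw : Measurable[𝒢 0] w := (Measurable.const_add (Finset.measurable_sum _ fun j _ =>
    measurable_norm.comp (hy.adapted 0 j)) 1).inv
  have hw0 (ω : Ω) : 0 < w ω := by positivity
  have hw1 (ω : Ω) : w ω ≤ 1 := inv_le_one_of_one_le₀ (le_add_of_nonneg_right (by positivity))
  refine hy.ae_summable_sum_norm_sub_mean_sq_of_weight hm hA hρ hu hG ha hw hw0 hw1 fun j => ?_
  refine MemLp.of_bound (((hy.smul_sub_mean hA hw).adapted 0 j).mono (𝒢.le 0)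
    le_rfl).aestronglyMeasurable 1 (Eventually.of_forall fun ω => ?_)
  rw [norm_smul, Real.norm_of_nonneg (hw0 ω).le, inv_mul_le_one₀ (by positivity)]
  linarith [norm_sub_mean_le_sum_norm hm (fun i => y 0 i ω) j]

end IsGossip

end Gossip

/-! ### Perturbed descent of the Fenchel coupling -/

section Descent

theorem exists_tendsto_of_le_sub_add {L d e n : ℕ → ℝ} (hL : ∀ k, 0 ≤ L k) (hd : ∀ k, 0 ≤ d k)
    (he : Summable e) (hn : ∃ l, Tendsto (fun N => ∑ k ∈ Finset.range N, n k) atTop (𝓝 l))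
    (h : ∀ k, L (k + 1) ≤ L k - d k + e k + n k) :
    (∃ l, Tendsto L atTop (𝓝 l)) ∧ Summable d := by
  obtain ⟨ln, hln⟩ := hn
  have herr := he.hasSum.tendsto_sum_nat.add hln
  let T : ℕ → ℝ := fun N => L N + ∑ k ∈ Finset.range N, d k -
    (∑ k ∈ Finset.range N, e k + ∑ k ∈ Finset.range N, n k)
  have hT : Antitone T := antitone_nat_of_succ_le fun N => by
    simp only [T, Finset.sum_range_succ]
    linarith [h N]
  have hd0 (N : ℕ) : 0 ≤ ∑ k ∈ Finset.range N, d k := Finset.sum_nonneg fun k _ => hd k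
  obtain ⟨M, hM⟩ := herr.bddAbove_range
  have hTbdd : BddBelow (Set.range T) := by
    refine ⟨-M, ?_⟩
    rintro _ ⟨N, rfl⟩
    linarith [hL N, hd0 N, hM ⟨N, rfl⟩]
  have hLd := ((tendsto_atTop_ciInf hT hTbdd).add herr).congr fun N =>
    sub_add_cancel (L N + ∑ k ∈ Finset.range N, d k) _
  obtain ⟨M', hM'⟩ := hLd.bddAbove_range
  have hdsum : Summable d := summable_of_sum_range_le (c := M') hd fun N => by
    linarith [hL N, hM' ⟨N, rfl⟩]
  exact ⟨⟨_, (hLd.sub hdsum.hasSum.tendsto_sum_nat).congr fun N => add_sub_cancel_right _ _⟩,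
    hdsum⟩

/-- The multiplicative perturbation becomes additive for `log (1 + R)`. -/
theorem exists_tendsto_of_le_sub_add_mul {R d e n : ℕ → ℝ} (hR : ∀ k, 0 ≤ R k)
    (hd : ∀ k, 0 ≤ d k) (he : ∀ k, 0 ≤ e k) (hesum : Summable e)
    (hn : ∃ l, Tendsto (fun N => ∑ k ∈ Finset.range N, n k) atTop (𝓝 l))
    (h : ∀ k, R (k + 1) ≤ R k - d k + e k + (1 + R k) * n k) :
    (∃ l, Tendsto R atTop (𝓝 l)) ∧ Summable d := by
  have hpos (k : ℕ) : 0 < 1 + R k := by linarith [hR k]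
  have hlog (k : ℕ) : Real.log (1 + R (k + 1)) ≤
      Real.log (1 + R k) - d k / (1 + R k) + e k + n k := by
    have hle := Real.log_le_sub_one_of_pos (div_pos (hpos (k + 1)) (hpos k))
    rw [Real.log_div (hpos _).ne' (hpos _).ne'] at hle
    have hratio : (1 + R (k + 1)) / (1 + R k) ≤ 1 - d k / (1 + R k) + e k + n k := by
      rw [div_le_iff₀ (hpos k)]
      calc 1 + R (k + 1) ≤ (1 + R k) - d k + e k * (1 + R k) + (1 + R k) * n k := by
            linarith [h k, mul_nonneg (he k) (hR k)]
        _ = (1 - d k / (1 + R k) + e k + n k) * (1 + R k) := by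
            field_simp [(hpos k).ne']
    linarith
  obtain ⟨⟨l, hl⟩, hsum⟩ := exists_tendsto_of_le_sub_add
    (fun k => Real.log_nonneg (le_add_of_nonneg_right (hR k)))
    (fun k => div_nonneg (hd k) (hpos k).le) hesum hn hlog
  have hRlim : Tendsto R atTop (𝓝 (Real.exp l - 1)) :=
    (((Real.continuous_exp.tendsto l).comp hl).sub_const 1).congr fun k => by
      simp only [Function.comp_apply, Real.exp_log (hpos k), add_sub_cancel_left]
  obtain ⟨M, hM⟩ := hRlim.bddAbove_range
  refine ⟨⟨_, hRlim⟩, Summable.of_nonneg_of_le hd (fun k => ?_) (hsum.mul_left (1 + M))⟩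
  calc d k = (1 + R k) * (d k / (1 + R k)) := by field_simp [(hpos k).ne']
    _ ≤ (1 + M) * (d k / (1 + R k)) :=
      mul_le_mul_of_nonneg_right (by linarith [hM ⟨k, rfl⟩]) (div_nonneg (hd k) (hpos k).le)

theorem frequently_lt_of_summable_mul {a b : ℕ → ℝ} (ha : ∀ k, 0 ≤ a k) (hadiv : ¬ Summable a)
    (hab : Summable fun k => a k * b k) {ε : ℝ} (hε : 0 < ε) : ∃ᶠ k in atTop, b k < ε := by
  refine fun hge => hadiv ((hab.mul_left ε⁻¹).of_norm_bounded_eventually_nat ?_)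
  filter_upwards [hge] with k hk
  rw [Real.norm_of_nonneg (ha k), le_inv_mul_iff₀ hε, mul_comm]
  exact mul_le_mul_of_nonneg_left (not_lt.1 hk) (ha k)

theorem exists_pos_forall_mem_of_lt_add {E : Type*} [PseudoMetricSpace E] [ProperSpace E]
    {X : Set E} (hX : IsClosed X) {f : E → ℝ} (hf : ContinuousOn f X) {p : E}
    (hmin : ∀ x ∈ X, x ≠ p → f p < f x) (r : ℝ) {U : Set E} (hU : U ∈ 𝓝 p) :
    ∃ ε > 0, ∀ x ∈ X, dist x p ≤ r → f x < f p + ε → x ∈ U := by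
  have hcompact : IsCompact ((X ∩ Metric.closedBall p r) \ interior U) :=
    ((isCompact_closedBall p r).inter_left hX).diff isOpen_interior
  obtain hempty | hne := ((X ∩ Metric.closedBall p r) \ interior U).eq_empty_or_nonempty
  · refine ⟨1, one_pos, fun x hx hr _ => interior_subset ?_⟩
    by_contra hxU
    exact Set.eq_empty_iff_forall_notMem.1 hempty x ⟨⟨hx, hr⟩, hxU⟩
  obtain ⟨z, ⟨⟨hzX, -⟩, hzU⟩, hz⟩ :=
    hcompact.exists_isMinOn hne (hf.mono fun x hx => hx.1.1)
  have hzp : z ≠ p := fun h => hzU (h ▸ mem_interior_iff_mem_nhds.2 hU)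
  refine ⟨f z - f p, sub_pos.2 (hmin z hzX hzp), fun x hx hr hlt => interior_subset ?_⟩
  by_contra hxU
  rw [add_sub_cancel] at hlt
  exact hlt.not_ge (hz ⟨⟨hx, hr⟩, hxU⟩)

/-- A divergent step sum makes the objective gap small infinitely often; at such times `Q (y k)` is
near `p`, where the coupling is half the squared distance, so its limit can only be `0`. -/
theorem IsConvexProjection.tendsto_of_coupling_le {E : Type*} [NormedAddCommGroup E]
    [InnerProductSpace ℝ E] [ProperSpace E] {X : Set E} {Q : E → E} (hQ : IsConvexProjection X Q)
    (hX : IsClosed X) {p : E} (hp : p ∈ X)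
    (hprolong : ∀ᶠ x in 𝓝[X] p, ∃ t > (0 : ℝ), x + t • (x - p) ∈ X)
    {f : E → ℝ} (hf : ContinuousOn f X) (hmin : ∀ x ∈ X, x ≠ p → f p < f x)
    {y : ℕ → E} {a e n : ℕ → ℝ} (ha : ∀ k, 0 ≤ a k) (hadiv : ¬ Summable a)
    (he : ∀ k, 0 ≤ e k) (hesum : Summable e)
    (hn : ∃ l, Tendsto (fun N => ∑ k ∈ Finset.range N, n k) atTop (𝓝 l))
    (hstep : ∀ k, coupling Q p (y (k + 1)) ≤ coupling Q p (y k) - a k * (f (Q (y k)) - f p) +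
      e k + (1 + coupling Q p (y k)) * n k) :
    Tendsto (fun k => Q (y k)) atTop (𝓝 p) := by
  have hgap (x : E) (hx : x ∈ X) : 0 ≤ f x - f p := by
    obtain rfl | hne := eq_or_ne x p
    exacts [(sub_self _).ge, (sub_pos.2 (hmin x hx hne)).le]
  obtain ⟨⟨l, hl⟩, hsum⟩ := exists_tendsto_of_le_sub_add_mul
    (fun k => hQ.coupling_nonneg hp (y k))
    (fun k => mul_nonneg (ha k) (hgap _ (hQ.mem (y k)))) he hesum hn hstep
  obtain ⟨M, hM⟩ := hl.bddAbove_range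
  have hnear {U : Set E} (hU : U ∈ 𝓝 p) : ∃ᶠ k in atTop, Q (y k) ∈ U := by
    obtain ⟨ε, hε, hεU⟩ := exists_pos_forall_mem_of_lt_add hX hf hmin (1 + M) hU
    refine (frequently_lt_of_summable_mul ha hadiv hsum hε).mono fun k hk =>
      hεU _ (hQ.mem _) ?_ (sub_lt_iff_lt_add'.1 hk)
    rw [dist_eq_norm]
    exact (hQ.norm_sub_le_one_add_coupling hp _).trans (by linarith [hM ⟨k, rfl⟩])
  have hl0 : l ≤ 0 := by
    by_contra! hpos
    have hball : ∀ᶠ x in 𝓝 p, ‖x - p‖ ^ 2 / 2 < l / 2 :=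
      ContinuousAt.eventually_lt (by fun_prop) continuousAt_const (by simpa using hpos)
    have hsmall := (hnear ((eventually_nhdsWithin_iff.1 hprolong).and hball)).mono fun k hk =>
      (hQ.coupling_eq_of_prolong hp (hk.1 (hQ.mem _))).trans_lt hk.2
    obtain ⟨k, hlt, hgt⟩ :=
      (hsmall.and_eventually (hl.eventually_const_lt (half_lt_self hpos))).exists
    exact lt_asymm hlt hgt
  rw [tendsto_iff_norm_sub_tendsto_zero]
  have hsq : Tendsto (fun k => ‖Q (y k) - p‖ ^ 2 / 2) atTop (𝓝 0) :=
    tendsto_of_tendsto_of_tendsto_of_le_of_le tendsto_const_nhds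
      ((ge_of_tendsto' hl fun k => hQ.coupling_nonneg hp _).antisymm hl0 ▸ hl)
      (fun k => by positivity) fun k => hQ.half_norm_sq_le_coupling hp _
  simpa using (hsq.mul_const 2).sqrt

theorem tendsto_weighted_mean {E : Type*} [NormedAddCommGroup E] [NormedSpace ℝ E] {a : ℕ → ℝ}
    (ha : ∀ k, 0 ≤ a k) (hs : Tendsto (fun n => ∑ k ∈ Finset.range n, a k) atTop atTop)
    {v : ℕ → E} {l : E} (hv : Tendsto v atTop (𝓝 l)) :
    Tendsto (fun n => (∑ k ∈ Finset.range n, a k)⁻¹ • ∑ k ∈ Finset.range n, a k • v k) atTop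
      (𝓝 l) := by
  have hone : (fun k => v k - l) =o[atTop] fun _ => (1 : ℝ) :=
    (Asymptotics.isLittleO_one_iff ℝ).2 (by simpa using hv.sub_const l)
  have hsmall : (fun k => a k • (v k - l)) =o[atTop] a := by
    simpa using (Asymptotics.isBigO_refl a atTop).smul_isLittleO hone
  have hmean := (hsmall.sum_range ha hs).norm_right.tendsto_inv_smul_nhds_zero.add_const l
  rw [zero_add] at hmean
  refine hmean.congr' ?_
  filter_upwards [hs.eventually_gt_atTop 0] with n hn
  rw [Real.norm_of_nonneg hn.le]
  simp only [smul_sub, Finset.sum_sub_distrib, ← Finset.sum_smul]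
  rw [smul_smul, inv_mul_cancel₀ hn.ne', one_smul, sub_add_cancel]

theorem tendsto_inv_sum_smul_of_step {E : Type*} [NormedAddCommGroup E] [NormedSpace ℝ E]
    {a : ℕ → ℝ} (ha : ∀ k, 0 ≤ a k)
    (hs : Tendsto (fun n => ∑ k ∈ Finset.range n, a k) atTop atTop)
    {y u v : ℕ → E} {l : E} (hstep : ∀ k, y (k + 1) = y k - a k • u k)
    (hnoise : ∃ w, Tendsto (fun n => ∑ k ∈ Finset.range n, a k • (u k - v k)) atTop (𝓝 w))
    (hv : Tendsto v atTop (𝓝 l)) :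
    Tendsto (fun n => (∑ k ∈ Finset.range n, a k)⁻¹ • y n) atTop (𝓝 (-l)) := by
  obtain ⟨w, hw⟩ := hnoise
  have hy (n : ℕ) : y n = y 0 - ∑ k ∈ Finset.range n, a k • (u k - v k) -
      ∑ k ∈ Finset.range n, a k • v k := by
    simp only [smul_sub, Finset.sum_sub_distrib]
    induction n with
    | zero => simp
    | succ n ih => rw [hstep, ih, Finset.sum_range_succ, Finset.sum_range_succ]; abel
  have hbdd := (tendsto_inv_atTop_zero.comp hs).smul (hw.const_sub (y 0))
  have hlim := hbdd.sub (tendsto_weighted_mean ha hs hv)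
  rw [zero_smul, zero_sub] at hlim
  exact hlim.congr fun n => by rw [hy n, smul_sub _ (_ - _)]; rfl

end Descent

/-! ### Distributed dual averaging with stochastic oracles -/

section OneStep

variable {E : Type*} [NormedAddCommGroup E] [InnerProductSpace ℝ E] {X : Set E} {Q : E → E}

/-- The direction from `p` to `Q y`, scaled down by the coupling. The gradient noise is tested
against this vector because it has norm at most one whatever the dual point `y` is. -/
noncomputable def scaledOffset (Q : E → E) (p y : E) : E := (1 + coupling Q p y)⁻¹ • (Q y - p)

namespace IsConvexProjection

theorem norm_scaledOffset_le_one (hQ : IsConvexProjection X Q) {p : E} (hp : p ∈ X) (y : E) :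
    ‖scaledOffset Q p y‖ ≤ 1 := by
  have hpos : 0 < 1 + coupling Q p y := by linarith [hQ.coupling_nonneg hp y]
  rw [scaledOffset, norm_smul, norm_inv, Real.norm_of_nonneg hpos.le, inv_mul_le_iff₀ hpos, mul_one]
  exact hQ.norm_sub_le_one_add_coupling hp y

theorem one_add_coupling_mul_inner_scaledOffset (hQ : IsConvexProjection X Q) {p : E} (hp : p ∈ X)
    (y w : E) : (1 + coupling Q p y) * ⟪w, scaledOffset Q p y⟫ = ⟪w, Q y - p⟫ := by
  have hpos : 0 < 1 + coupling Q p y := by linarith [hQ.coupling_nonneg hp y]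
  rw [scaledOffset, inner_smul_right, mul_inv_cancel_left₀ hpos.ne']

theorem measurable_scaledOffset [MeasurableSpace E] [BorelSpace E] [SecondCountableTopology E]
    (hQ : IsConvexProjection X Q) (p : E) : Measurable (scaledOffset Q p) :=
  ((hQ.continuous_coupling p).measurable.const_add 1).inv.smul
    (hQ.continuous.measurable.sub_const p)

theorem mul_sub_le_mul_inner (hQ : IsConvexProjection X Q) {f : E → ℝ} {G : E → E} {K : ℝ}
    (hsub : ∀ y, ∀ x ∈ X, f (Q y) + ⟪G y, x - Q y⟫ ≤ f x) (hG : ∀ y, ‖G y‖ ≤ K)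
    {p : E} (hp : p ∈ X) {a : ℝ} (ha : 0 ≤ a) (y z : E) :
    a * (f (Q z) - f p) - K * (a ^ 2 + ‖y - z‖ ^ 2) ≤ a * ⟪G y, Q z - p⟫ := by
  have hbound (w : E) {v : E} (hv : ‖v‖ ≤ ‖y - z‖) : -(K * ‖y - z‖) ≤ ⟪G w, v⟫ :=
    (neg_le_neg ((abs_real_inner_le_norm _ _).trans (mul_le_mul (hG w) hv (norm_nonneg _)
      ((norm_nonneg _).trans (hG w))))).trans (neg_abs_le _)
  have hyz := hbound y (norm_sub_rev y z ▸ hQ.norm_sub_le z y)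
  have hzy := hbound z (hQ.norm_sub_le y z)
  have hsplit : ⟪G y, Q z - p⟫ = ⟪G y, Q z - Q y⟫ - ⟪G y, p - Q y⟫ := by
    rw [← inner_sub_right, sub_sub_sub_cancel_right]
  have hlower : f (Q z) - f p - 2 * K * ‖y - z‖ ≤ ⟪G y, Q z - p⟫ := by
    linarith [hsub y p hp, hsub z _ (hQ.mem y)]
  have hK : 0 ≤ K := (norm_nonneg _).trans (hG y)
  linarith [mul_le_mul_of_nonneg_left hlower ha, mul_nonneg hK (sq_nonneg (a - ‖y - z‖))]

theorem coupling_mean_step_le {m : ℕ} (hm : 0 < m) (hQ : IsConvexProjection X Q)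
    {f : Fin m → E → ℝ} {G : Fin m → E → E} {K : ℝ}
    (hsub : ∀ j y, ∀ x ∈ X, f j (Q y) + ⟪G j y, x - Q y⟫ ≤ f j x) (hG : ∀ j y, ‖G j y‖ ≤ K)
    {p : E} (hp : p ∈ X) {a : ℝ} (ha : 0 ≤ a) (y g : Fin m → E) :
    coupling Q p (mean y - a • mean g) ≤ coupling Q p (mean y) -
      (m : ℝ)⁻¹ * a * (∑ j, f j (Q (mean y)) - ∑ j, f j p) +
      (m : ℝ)⁻¹ * ∑ j, (K * (a ^ 2 + ‖y j - mean y‖ ^ 2) + a ^ 2 * ‖g j‖ ^ 2) +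
      (1 + coupling Q p (mean y)) *
        -((m : ℝ)⁻¹ * ∑ j, a * ⟪g j - G j (y j), scaledOffset Q p (mean y)⟫) := by
  have hnoise : (1 + coupling Q p (mean y)) *
      -((m : ℝ)⁻¹ * ∑ j, a * ⟪g j - G j (y j), scaledOffset Q p (mean y)⟫) =
      -((m : ℝ)⁻¹ * ∑ j, a * ⟪g j - G j (y j), Q (mean y) - p⟫) := by
    simp only [← hQ.one_add_coupling_mul_inner_scaledOffset hp, mul_left_comm a,
      ← Finset.mul_sum]
    ring
  have hdrift : ⟪-(a • mean g), Q (mean y) - p⟫ =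
      -((m : ℝ)⁻¹ * ∑ j, a * ⟪g j - G j (y j), Q (mean y) - p⟫) -
      (m : ℝ)⁻¹ * ∑ j, a * ⟪G j (y j), Q (mean y) - p⟫ := by
    simp only [mean, inner_neg_left, real_inner_smul_left, sum_inner, inner_sub_left, mul_sub,
      Finset.sum_sub_distrib, ← Finset.mul_sum]
    ring
  have hsum : (m : ℝ)⁻¹ * a * (∑ j, f j (Q (mean y)) - ∑ j, f j p) -
      (m : ℝ)⁻¹ * ∑ j, K * (a ^ 2 + ‖y j - mean y‖ ^ 2) ≤
      (m : ℝ)⁻¹ * ∑ j, a * ⟪G j (y j), Q (mean y) - p⟫ := by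
    rw [mul_assoc, ← mul_sub, ← Finset.sum_sub_distrib, Finset.mul_sum, ← Finset.sum_sub_distrib]
    gcongr with j
    exact hQ.mul_sub_le_mul_inner (hsub j) (hG j) hp ha (y j) (mean y)
  have hquad : ‖-(a • mean g)‖ ^ 2 / 2 ≤ (m : ℝ)⁻¹ * ∑ j, a ^ 2 * ‖g j‖ ^ 2 := by
    rw [norm_neg, norm_smul, mul_pow, Real.norm_eq_abs, sq_abs, ← Finset.mul_sum, mul_left_comm]
    exact (half_le_self (by positivity)).trans
      (mul_le_mul_of_nonneg_left (norm_mean_sq_le hm g) (sq_nonneg a))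
  have hstep := hQ.coupling_add_le p (mean y) (-(a • mean g))
  rw [← sub_eq_add_neg, hdrift] at hstep
  rw [hnoise, Finset.sum_add_distrib, mul_add]
  linarith

end IsConvexProjection

end OneStep

/-- Distributed dual averaging `y_{k+1,j} = ∑_i [A_k]_{ji} y_{k,i} - a_k g_j(y_{k,j}, ζ_{j,k})` with
mixing random weights, fresh samples `ζ j k ∼ ν j` and stochastic oracles `g j` which are dominated,
uniformly in the dual point, by square-integrable functions `Λ j` of the sample. -/
structure IsDualAveraging {m : ℕ} {Ω E : Type*} [mΩ : MeasurableSpace Ω] [NormedAddCommGroup E]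
    [InnerProductSpace ℝ E] [MeasurableSpace E] {Ξ : Fin m → Type*} [∀ j, MeasurableSpace (Ξ j)]
    (μ : Measure Ω) (𝒢 : Filtration ℕ mΩ) (A : ℕ → Ω → Matrix (Fin m) (Fin m) ℝ) (ρ : ℝ)
    (ζ : (j : Fin m) → ℕ → Ω → Ξ j) (ν : (j : Fin m) → Measure (Ξ j))
    (g : (j : Fin m) → E → Ξ j → E) (Λ : (j : Fin m) → Ξ j → ℝ) (a : ℕ → ℝ)
    (y : ℕ → Fin m → Ω → E) : Prop where
  mixing : IsMixing μ 𝒢 A ρ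
  fresh : ∀ j, IsFresh μ 𝒢 (ζ j) (ν j)
  measurable_oracle : ∀ j, Measurable fun q : E × Ξ j => g j q.1 q.2
  memLp_envelope : ∀ j, MemLp (Λ j) 2 (ν j)
  norm_oracle_le : ∀ j u s, ‖g j u s‖ ≤ Λ j s
  gossip : IsGossip μ 𝒢 A a (fun k j ω => g j (y k j ω) (ζ j k ω)) y

namespace IsDualAveraging

variable {m : ℕ} {Ω E : Type*} [mΩ : MeasurableSpace Ω] [NormedAddCommGroup E]
  [InnerProductSpace ℝ E] [MeasurableSpace E]
  {Ξ : Fin m → Type*} [∀ j, MeasurableSpace (Ξ j)]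
  {μ : Measure Ω} {𝒢 : Filtration ℕ mΩ} {A : ℕ → Ω → Matrix (Fin m) (Fin m) ℝ} {ρ : ℝ}
  {ζ : (j : Fin m) → ℕ → Ω → Ξ j} {ν : (j : Fin m) → Measure (Ξ j)}
  {g : (j : Fin m) → E → Ξ j → E} {Λ : (j : Fin m) → Ξ j → ℝ} {a : ℕ → ℝ}
  {y : ℕ → Fin m → Ω → E}

theorem norm_integral_oracle_le (hy : IsDualAveraging μ 𝒢 A ρ ζ ν g Λ a y)
    [∀ j, IsFiniteMeasure (ν j)] (j : Fin m) (u : E) :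
    ‖∫ s, g j u s ∂ν j‖ ≤ ∑ i, ∫ s, Λ i s ∂ν i :=
  (norm_integral_le_of_norm_le ((hy.memLp_envelope j).integrable one_le_two)
    (Eventually.of_forall (hy.norm_oracle_le j u))).trans
    (Finset.single_le_sum (f := fun i => ∫ s, Λ i s ∂ν i)
      (fun i _ => integral_nonneg fun s => (norm_nonneg _).trans (hy.norm_oracle_le i 0 s))
      (Finset.mem_univ j))

variable [FiniteDimensional ℝ E] [BorelSpace E]

theorem memLp_oracle (hy : IsDualAveraging μ 𝒢 A ρ ζ ν g Λ a y) (k : ℕ) (j : Fin m) :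
    MemLp (fun ω => g j (y k j ω) (ζ j k ω)) 2 μ :=
  (hy.fresh j).memLp_of_norm_le (hy.memLp_envelope j)
    ((hy.measurable_oracle j).comp (((hy.gossip.adapted k j).mono (𝒢.le k) le_rfl).prodMk
      ((hy.fresh j).measurable k))).aestronglyMeasurable fun _ => hy.norm_oracle_le j _ _

theorem integral_sum_norm_oracle_sq_le (hy : IsDualAveraging μ 𝒢 A ρ ζ ν g Λ a y) (k : ℕ) :
    ∫ ω, ∑ j, ‖g j (y k j ω) (ζ j k ω)‖ ^ 2 ∂μ ≤ ∑ j, ∫ s, Λ j s ^ 2 ∂ν j := by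
  rw [integral_finsetSum _ fun j _ => (hy.memLp_oracle k j).integrable_norm_pow two_ne_zero]
  exact Finset.sum_le_sum fun j _ =>
    (hy.fresh j).integral_norm_sq_le (hy.memLp_envelope j) fun _ => hy.norm_oracle_le j _ _

theorem ae_summable_mul_sum_norm_oracle_sq (hy : IsDualAveraging μ 𝒢 A ρ ζ ν g Λ a y)
    (ha : Summable fun k => a k ^ 2) :
    ∀ᵐ ω ∂μ, Summable fun k => a k ^ 2 * ∑ j, ‖g j (y k j ω) (ζ j k ω)‖ ^ 2 := by
  refine ae_summable_of_summable_integral (fun k ω => by positivity)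
    (fun k => (integrable_finsetSum _ fun j _ =>
      (hy.memLp_oracle k j).integrable_norm_pow two_ne_zero).const_mul _) ?_
  simp only [integral_const_mul]
  exact (ha.mul_right _).of_nonneg_of_le (fun k => by positivity) fun k =>
    mul_le_mul_of_nonneg_left (hy.integral_sum_norm_oracle_sq_le k) (sq_nonneg _)

variable [IsProbabilityMeasure μ]

theorem ae_summable_sum_norm_sub_mean_sq (hm : 0 < m)
    (hy : IsDualAveraging μ 𝒢 A ρ ζ ν g Λ a y) (hρ : ρ < 1) (ha : Summable fun k => a k ^ 2) :
    ∀ᵐ ω ∂μ, Summable fun k => ∑ j, ‖y k j ω - mean fun i => y k i ω‖ ^ 2 :=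
  hy.gossip.ae_summable_sum_norm_sub_mean_sq hm hy.mixing hρ hy.memLp_oracle
    hy.integral_sum_norm_oracle_sq_le ha

theorem ae_exists_tendsto_sum_inner (hy : IsDualAveraging μ 𝒢 A ρ ζ ν g Λ a y)
    (ha : Summable fun k => a k ^ 2) {Y : E → E} (hY : Measurable Y) (hY1 : ∀ u, ‖Y u‖ ≤ 1) :
    ∀ᵐ ω ∂μ, ∃ l, Tendsto (fun n => ∑ k ∈ Finset.range n, ∑ j, a k *
      ⟪g j (y k j ω) (ζ j k ω) - ∫ s, g j (y k j ω) s ∂ν j, Y (mean fun i => y k i ω)⟫)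
      atTop (𝓝 l) := by
  have hcoord (j : Fin m) : Measurable fun q : (Fin m → E) × Ξ j => (q.1 j, q.2) := by fun_prop
  have hagent (j : Fin m) := (hy.fresh j).ae_exists_tendsto_sum_inner
    (U := fun k ω i => y k i ω) (g := fun (v : Fin m → E) s => g j (v j) s)
    (Y := fun v => Y (mean v))
    (fun k => @measurable_pi_lambda _ _ _ (𝒢 k) _ _ (hy.gossip.adapted k))
    (by exact (hy.measurable_oracle j).comp (hcoord j))
    (hy.memLp_envelope j) (fun _ => hy.norm_oracle_le j _)
    (hY.comp (measurable_mean measurable_pi_apply)) (fun _ => hY1 _) ha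
  filter_upwards [ae_all_iff.2 hagent] with ω hω
  choose l hl using hω
  exact ⟨_, (tendsto_finsetSum Finset.univ fun j _ => hl j).congr fun _ => Finset.sum_comm⟩

theorem ae_exists_tendsto_sum_smul (hy : IsDualAveraging μ 𝒢 A ρ ζ ν g Λ a y)
    (ha : Summable fun k => a k ^ 2) :
    ∀ᵐ ω ∂μ, ∃ w, Tendsto (fun n => ∑ k ∈ Finset.range n, a k •
      ((mean fun j => g j (y k j ω) (ζ j k ω)) - mean fun j => ∫ s, g j (y k j ω) s ∂ν j))
      atTop (𝓝 w) := by
  have hagent (j : Fin m) := (hy.fresh j).ae_exists_tendsto_sum_smul (U := fun k => y k j)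
    (fun k => hy.gossip.adapted k j) (hy.measurable_oracle j) (hy.memLp_envelope j)
    (hy.norm_oracle_le j) ha
  filter_upwards [ae_all_iff.2 hagent] with ω hω
  choose w hw using hω
  refine ⟨_, ((tendsto_finsetSum Finset.univ fun j _ => hw j).const_smul (m : ℝ)⁻¹).congr
    fun n => ?_⟩
  simp only [mean, ← smul_sub, ← Finset.sum_sub_distrib]
  rw [Finset.sum_comm, Finset.smul_sum]
  refine Finset.sum_congr rfl fun k _ => ?_
  rw [← Finset.smul_sum, smul_comm]

variable {X : Set E} {Q : E → E}

theorem ae_tendsto_projection_mean (hm : 0 < m) (hy : IsDualAveraging μ 𝒢 A ρ ζ ν g Λ a y)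
    (hρ : ρ < 1) (hQ : IsConvexProjection X Q) (hX : IsClosed X) {p : E} (hp : p ∈ X)
    (hprolong : ∀ᶠ x in 𝓝[X] p, ∃ t > (0 : ℝ), x + t • (x - p) ∈ X)
    {f : Fin m → E → ℝ} (hf : ∀ j, ContinuousOn (f j) X)
    (hmin : ∀ x ∈ X, x ≠ p → ∑ j, f j p < ∑ j, f j x)
    (hsub : ∀ j u, ∀ x ∈ X, f j (Q u) + ⟪∫ s, g j u s ∂ν j, x - Q u⟫ ≤ f j x)
    (ha0 : ∀ k, 0 ≤ a k) (ha : ¬ Summable a) (ha2 : Summable fun k => a k ^ 2) :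
    ∀ᵐ ω ∂μ, Tendsto (fun k => Q (mean fun j => y k j ω)) atTop (𝓝 p) := by
  have (j : Fin m) := (hy.fresh j).isProbabilityMeasure
  have hm' : (m : ℝ) ≠ 0 := by positivity
  have hK0 : 0 ≤ ∑ i, ∫ s, Λ i s ∂ν i :=
    (norm_nonneg _).trans (hy.norm_integral_oracle_le ⟨0, hm⟩ 0)
  filter_upwards [hy.ae_summable_sum_norm_sub_mean_sq hm hρ ha2,
    hy.ae_summable_mul_sum_norm_oracle_sq ha2, ae_all_iff.2 (hy.gossip.mean_step hy.mixing),
    hy.ae_exists_tendsto_sum_inner ha2 (hQ.measurable_scaledOffset p)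
      (hQ.norm_scaledOffset_le_one hp)] with ω hconsensus hsquares hstep ⟨l, hl⟩
  refine hQ.tendsto_of_coupling_le hX hp hprolong (continuousOn_finsetSum _ fun j _ => hf j) hmin
    (a := fun k => (m : ℝ)⁻¹ * a k) (fun k => mul_nonneg (by positivity) (ha0 k))
    (by rwa [summable_mul_left_iff (inv_ne_zero hm')])
    (e := fun k => (m : ℝ)⁻¹ * ∑ j, ((∑ i, ∫ s, Λ i s ∂ν i) *
      (a k ^ 2 + ‖y k j ω - mean fun i => y k i ω‖ ^ 2) +
        a k ^ 2 * ‖g j (y k j ω) (ζ j k ω)‖ ^ 2))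
    (n := fun k => -((m : ℝ)⁻¹ * ∑ j, a k * ⟪g j (y k j ω) (ζ j k ω) -
      ∫ s, g j (y k j ω) s ∂ν j, scaledOffset Q p (mean fun i => y k i ω)⟫))
    (fun k => by positivity) ?_
    ⟨_, (hl.const_mul (m : ℝ)⁻¹).neg.congr fun n => ?_⟩ fun k => ?_
  · simp only [Finset.sum_add_distrib, ← Finset.mul_sum, Finset.sum_const]
    exact (((ha2.const_smul _).add hconsensus).mul_left _ |>.add hsquares).mul_left _
  · rw [Finset.mul_sum, ← Finset.sum_neg_distrib]
  · rw [hstep k]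
    exact hQ.coupling_mean_step_le hm hsub hy.norm_integral_oracle_le hp (ha0 k) _ _

theorem ae_tendsto_inv_sum_smul_mean (hm : 0 < m) (hy : IsDualAveraging μ 𝒢 A ρ ζ ν g Λ a y)
    (hρ : ρ < 1) (hQ : IsConvexProjection X Q) {p : E}
    (hlim : ∀ᵐ ω ∂μ, Tendsto (fun k => Q (mean fun j => y k j ω)) atTop (𝓝 p)) {v : Fin m → E}
    (hv : ∀ j, Tendsto (fun u => ∫ s, g j u s ∂ν j) (comap Q (𝓝 p)) (𝓝 (v j)))
    (ha0 : ∀ k, 0 ≤ a k) (ha : ¬ Summable a) (ha2 : Summable fun k => a k ^ 2) :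
    ∀ᵐ ω ∂μ, Tendsto (fun n => (∑ k ∈ Finset.range n, a k)⁻¹ • mean fun j => y n j ω) atTop
      (𝓝 (-mean v)) := by
  filter_upwards [hlim, hy.ae_summable_sum_norm_sub_mean_sq hm hρ ha2,
    ae_all_iff.2 (hy.gossip.mean_step hy.mixing), hy.ae_exists_tendsto_sum_smul ha2]
    with ω hlim hconsensus hstep hnoise
  have hagent (j : Fin m) : Tendsto (fun k => Q (y k j ω)) atTop (𝓝 p) := by
    have hsq : Tendsto (fun k => ‖y k j ω - mean fun i => y k i ω‖ ^ 2) atTop (𝓝 0) :=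
      squeeze_zero (fun k => sq_nonneg _) (fun k => Finset.single_le_sum
        (f := fun j => ‖y k j ω - mean fun i => y k i ω‖ ^ 2) (fun j _ => sq_nonneg _)
        (Finset.mem_univ j)) hconsensus.tendsto_atTop_zero
    have hdist : Tendsto (fun k => Q (y k j ω) - Q (mean fun i => y k i ω)) atTop (𝓝 0) :=
      squeeze_zero_norm (fun k => hQ.norm_sub_le _ _) (by simpa using hsq.sqrt)
    simpa using hdist.add hlim
  exact tendsto_inv_sum_smul_of_step ha0
    ((not_summable_iff_tendsto_nat_atTop_of_nonneg ha0).1 ha) hstep hnoise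
    ((tendsto_finsetSum _ fun j _ => (hv j).comp (tendsto_comap_iff.2 (hagent j))).const_smul _)

end IsDualAveraging

/-! ### The algorithm as a dual averaging scheme on the span of the feasible set -/

section Measurability

theorem IsConvexProjection.measurable_uncurry_comp {E S G : Type*} [NormedAddCommGroup E]
    [InnerProductSpace ℝ E] [MeasurableSpace E] [BorelSpace E] [MeasurableSpace S]
    [MeasurableSpace G] {X : Set E} {Q : E → E} (hQ : IsConvexProjection X Q) {h : E → S → G}
    (hh : Measurable fun q : X × S => h q.1 q.2) : Measurable fun q : E × S => h (Q q.1) q.2 := by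
  have hQX : Measurable fun z => (⟨Q z, hQ.mem z⟩ : X) := hQ.continuous.measurable.subtype_mk
  exact hh.comp (f := fun q : E × S => (⟨Q q.1, hQ.mem q.1⟩, q.2))
    ((hQX.comp measurable_fst).prodMk measurable_snd)

variable {m d : ℕ} {Ω : Type*} {Ξ : Fin m → Type*} {z₀ : Fin m → Ω → Vec d}
  {ξ : (j : Fin m) → ℕ → Ω → Ξ j} {A : ℕ → Ω → Matrix (Fin m) (Fin m) ℝ}

theorem sum_neighbors_smul {E : Type*} [AddCommGroup E] [Module ℝ E] (A : Matrix (Fin m) (Fin m) ℝ)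
    (j : Fin m) (z : Fin m → E) : ∑ i ∈ neighbors A j, A j i • z i = ∑ i, max (A j i) 0 • z i := by
  rw [neighbors, Finset.sum_filter]
  refine Finset.sum_congr rfl fun i _ => ?_
  split_ifs with hi
  · rw [max_eq_left hi.le]
  · rw [max_eq_right (not_lt.1 hi), zero_smul]

theorem measurable_sum_neighbors_smul_sub {𝓂 : MeasurableSpace Ω}
    {A : Ω → Matrix (Fin m) (Fin m) ℝ} (hA : Measurable A) {z : Fin m → Ω → Vec d}
    (hz : ∀ i, Measurable (z i)) {g : Ω → Vec d} (hg : Measurable g) (a : ℝ) (j : Fin m) :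
    Measurable fun ω => ∑ i ∈ neighbors (A ω) j, A ω j i • z i ω - a • g ω := by
  simp only [sum_neighbors_smul]
  exact (Finset.measurable_sum _ fun i _ =>
    (((measurable_entry j i).comp hA).max measurable_const).smul (hz i)).sub (hg.const_smul a)

variable [∀ j, MeasurableSpace (Ξ j)]

theorem history_mono : Monotone (history z₀ ξ A) := fun _ _ hkl =>
  sup_le_sup (sup_le_sup le_rfl
    (iSup_mono fun _ => biSup_mono fun _ ht => ⟨ht.1, ht.2.trans_le hkl⟩))
    (biSup_mono fun _ ht => ⟨ht.1, ht.2.trans_le hkl⟩)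

theorem measurable_init_history (k : ℕ) (j : Fin m) : Measurable[history z₀ ξ A k] (z₀ j) :=
  measurable_iff_comap_le.2 <|
    (le_iSup (fun j => MeasurableSpace.comap (z₀ j) inferInstance) j).trans
      (le_sup_left.trans le_sup_left)

theorem measurable_sample_history (k : ℕ) (j : Fin m) :
    Measurable[history z₀ ξ A (k + 2)] (ξ j (k + 1)) :=
  measurable_iff_comap_le.2 <|
    ((le_iSup₂ (f := fun t (_ : t ∈ Set.Ico 1 (k + 2)) =>
      MeasurableSpace.comap (ξ j t) inferInstance) (k + 1) (by simp)).trans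
      (le_iSup (fun j => ⨆ t ∈ Set.Ico 1 (k + 2), MeasurableSpace.comap (ξ j t) inferInstance)
        j)).trans (le_sup_right.trans le_sup_left)

theorem measurable_weight_history (k : ℕ) : Measurable[history z₀ ξ A (k + 2)] (A (k + 1)) :=
  measurable_iff_comap_le.2 <|
    (le_iSup₂ (f := fun t (_ : t ∈ Set.Ico 1 (k + 2)) =>
      MeasurableSpace.comap (A t) inferInstance) (k + 1) (by simp)).trans le_sup_right

/-- The histories as a filtration, shifted so that the dual variables of time `k` are adapted: its
`k`-th σ-algebra is `𝓕_{k+1}`. -/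
def historyFiltration [mΩ : MeasurableSpace Ω] (hz : ∀ j, Measurable (z₀ j))
    (hξ : ∀ j, ∀ k ≥ 1, Measurable (ξ j k)) (hA : ∀ k ≥ 1, Measurable (A k)) :
    Filtration ℕ mΩ where
  seq k := history z₀ ξ A (k + 1)
  mono' _ _ hkl := history_mono (Nat.succ_le_succ hkl)
  le' _ := sup_le (sup_le (iSup_le fun j => (hz j).comap_le)
    (iSup_le fun j => iSup₂_le fun t ht => (hξ j t ht.1).comap_le))
    (iSup₂_le fun t ht => (hA t ht.1).comap_le)

theorem measurable_dual {X : Set (Vec d)} {ψ : Vec d → ℝ}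
    {gradF : (j : Fin m) → Vec d → Ξ j → Vec d}
    (hgrad : ∀ j, Measurable fun q : Vec d × Ξ j => gradF j (mirrorMap ψ X q.1) q.2)
    (α : ℕ → ℝ) (k : ℕ) (j : Fin m) :
    Measurable[history z₀ ξ A (k + 1)] (dual X ψ gradF α z₀ ξ A k j) := by
  induction k generalizing j with
  | zero => exact measurable_init_history 1 j
  | succ k ih =>
    have hdual (i : Fin m) : Measurable[history z₀ ξ A (k + 2)] (dual X ψ gradF α z₀ ξ A k i) :=
      (ih i).mono (history_mono (Nat.le_succ _)) le_rfl
    exact measurable_sum_neighbors_smul_sub (measurable_weight_history k) hdual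
      ((hgrad j).comp ((hdual j).prodMk (measurable_sample_history k j))) _ j

end Measurability

namespace ObjectiveAssumption

variable {m d : ℕ} {Ξ : Fin m → Type*} [∀ j, MeasurableSpace (Ξ j)] {X : Set (Vec d)}
  {F : (j : Fin m) → Vec d → Ξ j → ℝ} {gradF : (j : Fin m) → Vec d → Ξ j → Vec d}
  {ν : (j : Fin m) → Measure (Ξ j)}

theorem convexOn_localObjective (hobj : ObjectiveAssumption X F gradF ν) (hX : Convex ℝ X)
    (j : Fin m) : ConvexOn ℝ X (localObjective F ν j) :=
  integral_convexOn_of_integrand_ae hX (ae_of_all _ (hobj.convex j)) (hobj.integrable j)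

theorem measurable_gradF (hobj : ObjectiveAssumption X F gradF ν) (j : Fin m) {x : Vec d}
    (hx : x ∈ X) : Measurable (gradF j x) :=
  (hobj.measurable_grad j).comp (measurable_prodMk_left (x := (⟨x, hx⟩ : X)))

variable {d₁ d₂ : ℕ} {B : Matrix (Fin d₁) (Fin d) ℝ} {b : Fin d₁ → ℝ}
  {C : Matrix (Fin d₂) (Fin d) ℝ} {c : Fin d₂ → ℝ}

theorem objective_lt_of_ne {p : Vec d} {gradf : Fin m → Vec d → Vec d} {hess : Vec d →L[ℝ] Vec d}
    (hobj : ObjectiveAssumption (feasibleSet B b C c) F gradF ν)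
    (hopt : p ∈ optimalSet (objective F ν) (feasibleSet B b C c)) (hactive : B *ᵥ p.ofLp = b)
    (hgradf : ∀ j, ∀ x ∈ feasibleSet B b C c,
      HasGradientWithinAt (localObjective F ν j) (gradf j x) (feasibleSet B b C c) x)
    (hhess : HasFDerivWithinAt (fun x => ∑ j, gradf j x) hess (feasibleSet B b C c) p)
    (hpos : ∀ x : Vec d, x ≠ 0 → B *ᵥ x.ofLp = 0 → 0 < ⟪x, hess x⟫)
    (hnondeg : -∑ j, gradf j p ∈
      intrinsicInterior ℝ (normalCone (feasibleSet B b C c) p)) {x : Vec d}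
    (hx : x ∈ feasibleSet B b C c) (hxp : x ≠ p) : objective F ν p < objective F ν x := by
  obtain ⟨r, hr, hsharp⟩ := exists_sharp_of_mem_intrinsicInterior hnondeg
  have hconvex : ConvexOn ℝ (feasibleSet B b C c) (objective F ν) :=
    ⟨convex_feasibleSet, fun x hx y hy s t hs ht hst => by
      simpa only [objective, Finset.smul_sum, ← Finset.sum_add_distrib] using
        Finset.sum_le_sum fun j _ =>
          (hobj.convexOn_localObjective convex_feasibleSet j).2 hx hy hs ht hst⟩
  have hgrad (y : Vec d) (hy : y ∈ feasibleSet B b C c) :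
      HasGradientWithinAt (objective F ν) (∑ j, gradf j y) (feasibleSet B b C c) y := by
    rw [hasGradientWithinAt_iff_hasFDerivWithinAt, map_sum]
    exact HasFDerivWithinAt.fun_sum fun j _ => (hgradf j y hy).hasFDerivWithinAt
  by_contra! hle
  refine hxp (eq_of_isMinOn_of_hessian_pos hconvex hgrad hhess hopt.1 hx hopt.2 hle
    fun hzero hne => hpos _ (sub_ne_zero.2 hne) ?_)
  have hnormal : (Submodule.span ℝ (normalCone (feasibleSet B b C c) p)).starProjection
      (x - p) = 0 := by
    have := hsharp x hx
    rw [inner_neg_left, hzero, neg_neg] at this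
    exact norm_le_zero_iff.1 (nonpos_of_mul_nonpos_right this hr)
  rw [WithLp.ofLp_sub, Matrix.mulVec_sub, mulVec_eq_of_starProjection_eq_zero hactive hnormal,
    hactive, sub_self]

variable [∀ j, IsFiniteMeasure (ν j)]

theorem exists_memLp_lipschitz (hobj : ObjectiveAssumption X F gradF ν) (j : Fin m) :
    ∃ L : Ξ j → ℝ, MemLp L 2 (ν j) ∧ (∀ s, 0 ≤ L s) ∧
      ∀ s, ∀ x ∈ X, ∀ y ∈ X, |F j x s - F j y s| ≤ L s * ‖x - y‖ := by
  obtain ⟨p, L, hp, -, hL, hlip⟩ := hobj.lipschitz j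
  refine ⟨fun s => |L s|, (hL.mono_exponent ?_).abs, fun s => abs_nonneg _, fun s x hx y hy =>
    (hlip s x hx y hy).trans (mul_le_mul_of_nonneg_right (le_abs_self _) (norm_nonneg _))⟩
  simpa only [ENNReal.ofReal_ofNat] using ENNReal.ofReal_le_ofReal hp

theorem exists_memLp_norm_starProjection_gradF_le
    (hobj : ObjectiveAssumption (feasibleSet B b C c) F gradF ν) (j : Fin m) :
    ∃ Λ : Ξ j → ℝ, MemLp Λ 2 (ν j) ∧ ∀ x ∈ feasibleSet B b C c, ∀ s,
      ‖(vectorSpan ℝ (feasibleSet B b C c)).starProjection (gradF j x s)‖ ≤ Λ s := by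
  obtain ⟨L, hL, hL0, hlip⟩ := hobj.exists_memLp_lipschitz j
  obtain ⟨K, -, hK⟩ := exists_norm_starProjection_vectorSpan_le
    (Sum.elim (rowVec B) (rowVec C)) (Sum.elim b c)
  rw [← feasibleSet_eq_polyhedron] at hK
  exact ⟨fun s => K * L s, hL.const_mul K, fun x hx s => hK x hx _ _ (hL0 s) fun _ =>
    abs_inner_le_of_lipschitz (hobj.hasGradient j s x hx) fun y hy => hlip s y hy x hx⟩

theorem integral_starProjection_gradF (hobj : ObjectiveAssumption (feasibleSet B b C c) F gradF ν)
    {j : Fin m} {x G : Vec d} (hx : x ∈ feasibleSet B b C c)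
    (hG : HasGradientWithinAt (localObjective F ν j) G (feasibleSet B b C c) x) :
    ∫ s, (vectorSpan ℝ (feasibleSet B b C c)).starProjection (gradF j x s) ∂ν j =
      (vectorSpan ℝ (feasibleSet B b C c)).starProjection G := by
  obtain ⟨Λ, hΛ, hΛ_le⟩ := hobj.exists_memLp_norm_starProjection_gradF_le j
  obtain ⟨L, hL, -, hlip⟩ := hobj.exists_memLp_lipschitz j
  refine integral_starProjection_gradient convex_feasibleSet (hobj.integrable j)
    (hL.integrable one_le_two) hlip hx (fun s => hobj.hasGradient j s x hx) hG ?_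
  exact (hΛ.integrable one_le_two).mono'
    ((ContinuousLinearMap.continuous _).measurable.comp
      (hobj.measurable_gradF j hx)).aestronglyMeasurable (ae_of_all _ (hΛ_le x hx))

theorem localObjective_add_inner_le (hobj : ObjectiveAssumption (feasibleSet B b C c) F gradF ν)
    {j : Fin m} {x y G : Vec d} (hx : x ∈ feasibleSet B b C c) (hy : y ∈ feasibleSet B b C c)
    (hG : HasGradientWithinAt (localObjective F ν j) G (feasibleSet B b C c) x) :
    localObjective F ν j x + ⟪∫ s, (vectorSpan ℝ (feasibleSet B b C c)).starProjection
      (gradF j x s) ∂ν j, y - x⟫ ≤ localObjective F ν j y := by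
  rw [hobj.integral_starProjection_gradF hx hG, inner_starProjection_vectorSpan hy hx]
  exact add_inner_le_of_convexOn (hobj.convexOn_localObjective convex_feasibleSet j) hx hG hy

theorem tendsto_integral_starProjection_gradF
    (hobj : ObjectiveAssumption (feasibleSet B b C c) F gradF ν) {p : Vec d} {j : Fin m}
    {G : Vec d → Vec d} (hG : ∀ x ∈ feasibleSet B b C c,
      HasGradientWithinAt (localObjective F ν j) (G x) (feasibleSet B b C c) x)
    (hcont : ContinuousWithinAt G (feasibleSet B b C c) p) {Q : Vec d → Vec d}
    (hQ : ∀ z, Q z ∈ feasibleSet B b C c) :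
    Tendsto (fun z => ∫ s, (vectorSpan ℝ (feasibleSet B b C c)).starProjection
      (gradF j (Q z) s) ∂ν j) (comap Q (𝓝 p))
      (𝓝 ((vectorSpan ℝ (feasibleSet B b C c)).starProjection (G p))) := by
  have hQp : Tendsto Q (comap Q (𝓝 p)) (𝓝[feasibleSet B b C c] p) :=
    tendsto_nhdsWithin_iff.2 ⟨tendsto_comap, Eventually.of_forall hQ⟩
  simp only [fun z => hobj.integral_starProjection_gradF (hQ z) (hG _ (hQ z))]
  exact ((ContinuousLinearMap.continuous _).tendsto _).comp (hcont.tendsto.comp hQp)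

end ObjectiveAssumption

section Convergence

variable {m d d₁ d₂ : ℕ} {Ω : Type*} [MeasurableSpace Ω] {μ : Measure Ω}
  {Ξ : Fin m → Type*} [∀ j, MeasurableSpace (Ξ j)] {ν : (j : Fin m) → Measure (Ξ j)}
  {B : Matrix (Fin d₁) (Fin d) ℝ} {b : Fin d₁ → ℝ} {C : Matrix (Fin d₂) (Fin d) ℝ} {c : Fin d₂ → ℝ}
  {F : (j : Fin m) → Vec d → Ξ j → ℝ} {gradF : (j : Fin m) → Vec d → Ξ j → Vec d}

/-- Gradients relative to `X` are only controlled along the span of `X`, hence the projection. It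
does not change the primal iterates, since `Q ∘ P = Q`. -/
theorem isDualAveraging_starProjection_dual {p : Vec d} (hp : p ∈ feasibleSet B b C c)
    {z₀ : Fin m → Ω → Vec d} {ξ : (j : Fin m) → ℕ → Ω → Ξ j}
    {A : ℕ → Ω → Matrix (Fin m) (Fin m) ℝ} {step : ℕ → ℝ} {ρ : ℝ} {Λ : (j : Fin m) → Ξ j → ℝ}
    (hgrad : ∀ j, Measurable fun q : feasibleSet B b C c × Ξ j => gradF j q.1 q.2)
    (hΛ : ∀ j, MemLp (Λ j) 2 (ν j))
    (hΛ_le : ∀ j, ∀ x ∈ feasibleSet B b C c, ∀ s,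
      ‖(vectorSpan ℝ (feasibleSet B b C c)).starProjection (gradF j x s)‖ ≤ Λ j s)
    (hz₀ : ∀ j, Measurable (z₀ j)) (hξ : ∀ j, ∀ k ≥ 1, Measurable (ξ j k))
    (hlaw : ∀ j, ∀ k ≥ 1, μ.map (ξ j k) = ν j)
    (hfresh : ∀ j, ∀ k ≥ 1,
      Indep (MeasurableSpace.comap (ξ j k) inferInstance) (history z₀ ξ A k) μ)
    (hA : ∀ k ≥ 1, Measurable (A k))
    (hstoch : ∀ k ≥ 1, ∀ᵐ ω ∂μ, A k ω ∈ doublyStochastic ℝ (Fin m))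
    (hindep : ∀ k ≥ 1, Indep (MeasurableSpace.comap (A k) inferInstance) (history z₀ ξ A k) μ)
    (hmix : ∀ k ≥ 1, mixingNorm μ (A k) ≤ ρ) :
    IsDualAveraging μ (historyFiltration hz₀ hξ hA) (fun k => A (k + 1)) ρ
      (fun j k => ξ j (k + 1)) ν
      (fun j z s => (vectorSpan ℝ (feasibleSet B b C c)).starProjection
        (gradF j (mirrorMap euclideanReg (feasibleSet B b C c) z) s)) Λ (fun k => step (k + 1))
      (fun k j ω => (vectorSpan ℝ (feasibleSet B b C c)).starProjection
        (dual (feasibleSet B b C c) euclideanReg gradF step z₀ ξ A k j ω)) := by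
  set P := (vectorSpan ℝ (feasibleSet B b C c)).starProjection
  have hQ := isConvexProjection_mirrorMap_feasibleSet ⟨p, hp⟩
  have hgradQ (j : Fin m) := hQ.measurable_uncurry_comp (hgrad j)
  exact
    { mixing := ⟨fun k => hA _ k.succ_pos, fun k => hstoch _ k.succ_pos,
        fun k => hindep _ k.succ_pos, fun k => hmix _ k.succ_pos⟩
      fresh := fun j => ⟨fun k => measurable_sample_history k j, fun k => hlaw j _ k.succ_pos,
        fun k => hfresh j _ k.succ_pos⟩
      measurable_oracle := fun j => P.continuous.measurable.comp (hgradQ j)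
      memLp_envelope := hΛ
      norm_oracle_le := fun j z => hΛ_le j _ (hQ.mem z)
      gossip :=
        { adapted := fun k j => P.continuous.measurable.comp (measurable_dual hgradQ step k j)
          step := fun k => by
            filter_upwards [hstoch (k + 1) k.succ_pos] with ω hω j
            have hmax (i : Fin m) : max (A (k + 1) ω j i) 0 = A (k + 1) ω j i :=
              max_eq_left (nonneg_of_mem_doublyStochastic hω)
            simp only [dual, sum_neighbors_smul, hmax, P, hQ.apply_starProjection_vectorSpan,
              map_sub, map_sum, map_smul] } }

end Convergence

section StepSizes

theorem summable_div_rpow_sq {a α : ℝ} (hα : 1 / 2 < α) :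
    Summable fun k : ℕ => (a / ((k + 1 : ℕ) : ℝ) ^ α) ^ 2 := by
  have hsum : Summable fun k : ℕ => a ^ 2 * (1 / (k : ℝ) ^ (α * 2)) :=
    (Real.summable_one_div_nat_rpow.2 (by linarith)).mul_left _
  refine ((summable_nat_add_iff 1).2 hsum).congr fun k => ?_
  rw [div_pow, Real.rpow_mul (Nat.cast_nonneg _), Real.rpow_ofNat, mul_one_div]

theorem not_summable_div_rpow {a α : ℝ} (ha : a ≠ 0) (hα : α ≤ 1) :
    ¬ Summable fun k : ℕ => a / ((k + 1 : ℕ) : ℝ) ^ α := by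
  have hshift := summable_nat_add_iff (f := fun k : ℕ => a / (k : ℝ) ^ α) 1
  simp only [div_eq_mul_inv] at hshift ⊢
  rw [hshift, summable_mul_left_iff ha, Real.summable_nat_rpow_inv]
  exact hα.not_gt

end StepSizes

end DDA

open DDA

theorem mainTheorem3_general {m d d₁ d₂ : ℕ} (hm : 0 < m)
    {Ω : Type*} [MeasurableSpace Ω] (μ : Measure Ω) [IsProbabilityMeasure μ]
    {Ξ : Fin m → Type*} [∀ j, MeasurableSpace (Ξ j)] (ν : (j : Fin m) → Measure (Ξ j))
    (B : Matrix (Fin d₁) (Fin d) ℝ) (b : Fin d₁ → ℝ)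
    (C : Matrix (Fin d₂) (Fin d) ℝ) (c : Fin d₂ → ℝ)
    (F : (j : Fin m) → Vec d → Ξ j → ℝ) (gradF : (j : Fin m) → Vec d → Ξ j → Vec d)
    (gradf : Fin m → Vec d → Vec d) (hess : Vec d →L[ℝ] Vec d) (xstar : Vec d)
    (z₀ : Fin m → Ω → Vec d) (ξ : (j : Fin m) → ℕ → Ω → Ξ j)
    (A : ℕ → Ω → Matrix (Fin m) (Fin m) ℝ)
    (hopt : xstar ∈ optimalSet (objective F ν) (feasibleSet B b C c))
    (hactive : B *ᵥ xstar.ofLp = b) (hinactive : ∀ i, (C *ᵥ xstar.ofLp) i < c i)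
    (hobj : ObjectiveAssumption (feasibleSet B b C c) F gradF ν)
    (hgradf : ∀ j, ∀ x ∈ feasibleSet B b C c,
      HasGradientWithinAt (localObjective F ν j) (gradf j x) (feasibleSet B b C c) x)
    (hgradf_cont : ∀ j, ContinuousWithinAt (gradf j) (feasibleSet B b C c) xstar)
    (hhess : HasFDerivWithinAt (fun x => ∑ j, gradf j x) hess (feasibleSet B b C c) xstar)
    (hhess_pos : ∀ x : Vec d, x ≠ 0 → B *ᵥ x.ofLp = 0 → 0 < ⟪x, hess x⟫)
    (hnondeg : -(∑ j, gradf j xstar) ∈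
      intrinsicInterior ℝ (normalCone (feasibleSet B b C c) xstar))
    (hz₀ : ∀ j, Measurable (z₀ j)) (hξ : ∀ j, ∀ k ≥ 1, Measurable (ξ j k))
    (hlaw : ∀ j, ∀ k ≥ 1, μ.map (ξ j k) = ν j)
    (hfresh : ∀ j, ∀ k ≥ 1,
      Indep (MeasurableSpace.comap (ξ j k) inferInstance) (history z₀ ξ A k) μ)
    (hA : ∀ k ≥ 1, Measurable (A k))
    (hstoch : ∀ k ≥ 1, ∀ᵐ ω ∂μ, A k ω ∈ doublyStochastic ℝ (Fin m))
    (hindep : ∀ k ≥ 1, Indep (MeasurableSpace.comap (A k) inferInstance) (history z₀ ξ A k) μ)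
    (ρ : ℝ) (hρ : ρ < 1) (hmix : ∀ k ≥ 1, mixingNorm μ (A k) ≤ ρ)
    (step : ℕ → ℝ) (hstep : ∀ k, 0 ≤ step (k + 1)) (hstep_sum : ¬ Summable fun k => step (k + 1))
    (hstep_sq : Summable fun k => step (k + 1) ^ 2) :
    ∀ᵐ ω ∂μ, ∃ K ≥ 1, ∀ k ≥ K,
      B *ᵥ (primalAvg (feasibleSet B b C c) euclideanReg gradF step z₀ ξ A k ω).ofLp = b ∧
      ∀ i, (C *ᵥ (primalAvg (feasibleSet B b C c) euclideanReg gradF step z₀ ξ A k ω).ofLp) i <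
        c i := by
  have (j : Fin m) : IsProbabilityMeasure (ν j) :=
    hlaw j 1 le_rfl ▸ Measure.isProbabilityMeasure_map (hξ j 1 le_rfl).aemeasurable
  set P := (vectorSpan ℝ (feasibleSet B b C c)).starProjection
  have hQ := isConvexProjection_mirrorMap_feasibleSet ⟨xstar, hopt.1⟩
  choose Λ hΛ hΛ_le using hobj.exists_memLp_norm_starProjection_gradF_le
  have hy := isDualAveraging_starProjection_dual (step := step) hopt.1 hobj.measurable_grad hΛ
    hΛ_le hz₀ hξ hlaw hfresh hA hstoch hindep hmix
  have hprimal := hy.ae_tendsto_projection_mean hm hρ hQ isClosed_feasibleSet hopt.1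
    (eventually_prolong_mem_feasibleSet hopt.1)
    (fun j x hx => (hgradf j x hx).continuousWithinAt)
    (fun x hx => hobj.objective_lt_of_ne hopt hactive hgradf hhess hhess_pos hnondeg hx)
    (fun j z x hx => hobj.localObjective_add_inner_le (hQ.mem z) hx (hgradf j _ (hQ.mem z)))
    hstep hstep_sum hstep_sq
  have hmean (v : Fin m → Vec d) : -mean (fun j => P (v j)) = (m : ℝ)⁻¹ • P (-∑ j, v j) := by
    simp only [mean, ← map_sum, map_neg, smul_neg]
  have hdual := hy.ae_tendsto_inv_sum_smul_mean hm hρ hQ hprimal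
    (fun j => hobj.tendsto_integral_starProjection_gradF (hgradf j) (hgradf_cont j) hQ.mem)
    hstep hstep_sum hstep_sq
  rw [hmean] at hdual
  filter_upwards [hprimal, hdual] with ω hprimal hdual
  obtain ⟨N, hN⟩ := eventually_atTop.1 <| eventually_active_of_tendsto hactive hinactive hnondeg
    (inv_pos.2 (Nat.cast_pos.2 hm)) ((not_summable_iff_tendsto_nat_atTop_of_nonneg hstep).1
      hstep_sum) hdual hprimal
  refine ⟨N + 1, by omega, fun k hk => ?_⟩
  rw [primalAvg, ← hQ.apply_starProjection_vectorSpan, dualAvg, map_smul, map_sum]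
  exact hN (k - 1) (by omega)

theorem mainTheorem3 {m d d₁ d₂ : ℕ} (hm : 0 < m)
    {Ω : Type*} [MeasurableSpace Ω] (μ : Measure Ω) [IsProbabilityMeasure μ]
    {Ξ : Fin m → Type*} [∀ j, MeasurableSpace (Ξ j)] (ν : (j : Fin m) → Measure (Ξ j))
    (B : Matrix (Fin d₁) (Fin d) ℝ) (b : Fin d₁ → ℝ)
    (C : Matrix (Fin d₂) (Fin d) ℝ) (c : Fin d₂ → ℝ)
    (F : (j : Fin m) → DDA.Vec d → Ξ j → ℝ)
    (gradF : (j : Fin m) → DDA.Vec d → Ξ j → DDA.Vec d)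
    (gradf : Fin m → DDA.Vec d → DDA.Vec d)
    (hess : DDA.Vec d →L[ℝ] DDA.Vec d) (xstar : DDA.Vec d)
    (z₀ : Fin m → Ω → DDA.Vec d) (ξ : (j : Fin m) → ℕ → Ω → Ξ j)
    (A : ℕ → Ω → Matrix (Fin m) (Fin m) ℝ)
    (hopt : xstar ∈ DDA.optimalSet (DDA.objective F ν) (DDA.feasibleSet B b C c))
    (hactive : B *ᵥ xstar.ofLp = b) (hinactive : ∀ i, (C *ᵥ xstar.ofLp) i < c i)
    (hobj : DDA.ObjectiveAssumption (DDA.feasibleSet B b C c) F gradF ν)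
    (hreg : DDA.RegularityAssumption (DDA.feasibleSet B b C c) B F ν gradf hess xstar)
    (hnondeg : -(∑ j, gradf j xstar) ∈
      intrinsicInterior ℝ (DDA.normalCone (DDA.feasibleSet B b C c) xstar))
    (hsample : DDA.SampleAssumption μ ν z₀ ξ A)
    (hweight : DDA.WeightAssumption μ z₀ ξ A)
    (a α : ℝ) (ha : 0 < a) (hα : 2 / 3 < α) (hα' : α < 1)
    (step : ℕ → ℝ) (hstep : ∀ k ≥ 1, step k = a / (k : ℝ) ^ α) :
    ∀ᵐ ω ∂μ, ∃ K ≥ 1, ∀ k ≥ K,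
      B *ᵥ (DDA.primalAvg (DDA.feasibleSet B b C c) DDA.euclideanReg gradF step z₀ ξ A k ω).ofLp
          = b ∧
      ∀ i, (C *ᵥ (DDA.primalAvg (DDA.feasibleSet B b C c) DDA.euclideanReg gradF step z₀ ξ A
          k ω).ofLp) i < c i := by
  have hstep' (k : ℕ) : step (k + 1) = a / ((k + 1 : ℕ) : ℝ) ^ α := hstep _ k.succ_pos
  obtain ⟨κ, hκ, hconvex⟩ := hreg.restrictedStrongConvexity
  have hcont (j : Fin m) : ContinuousWithinAt (gradf j) (feasibleSet B b C c) xstar := by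
    obtain ⟨L, -, hlip⟩ := hreg.lipschitz j
    exact (LipschitzOnWith.of_dist_le' (K := L) fun x hx y hy => by
      simpa only [dist_eq_norm] using hlip x hx y hy).continuousOn xstar hopt.1
  exact mainTheorem3_general hm μ ν B b C c F gradF gradf hess xstar z₀ ξ A hopt hactive hinactive
    hobj hreg.hasGradient hcont hreg.hasHessian
    (fun x hx hBx => (by positivity : 0 < κ * ‖x‖ ^ 2).trans_le (hconvex x hBx)) hnondeg
    hsample.measurable_init hsample.measurable hsample.law hsample.fresh hweight.measurable
    hweight.stochastic hweight.indep_history (mixingNorm μ (A 1)) (hweight.mixing 1 le_rfl)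
    (fun k hk => (mixingNorm_eq_of_identDistrib (hweight.identDistrib k hk)).le) step
    (fun k => hstep' k ▸ by positivity)
    (by simpa only [hstep'] using not_summable_div_rpow ha.ne' hα'.le)
    (by simpa only [hstep'] using summable_div_rpow_sq (by linarith))
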